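/- Let $G$ be a discrete group and $A$ a $C^*$-algebra. A partial action $\alpha$ of $G$ on $A$ consists of closed two-sided ideals $D_s$ of $A$ and $*$-isomorphisms $\alpha_s\colon D_{s^{-1}}\to D_s$ ($s\in G$) such that $D_e=A$ and $\alpha_{st}$ extends $\alpha_s\circ\alpha_t$ (with domain $\alpha_t^{-1}(D_{s^{-1}})$) for all $s,t\in G$. Let $L_c$ be the $*$-algebra of finitely supported functions $f\colon G\to A$ with $f(s)\in D_s$ for all $s$; writing $F(a,s)$ for the function with value $a\in D_s$ at $s$ and $0$ elsewhere, its operations are determined by \[ F(a,s)F(b,t)=F(\alpha_s(\alpha_s^{-1}(a)b),st),\qquad F(a,s)^*=F(\alpha_s^{-1}(a^*),s^{-1}). \] The crossed product $A\rtimes_\alpha G$ is the completion of $L_c$ in its greatest $C^*$-seminorm, and $A$ is mapped into it by $a\mapsto F(a,e)$. For a $C^*$-algebra $E$ we regard the multiplier algebra as $M(E)=\{x\in E^{**}: xE\cup Ex\subset E\}$, where $E^{**}$ is the double dual (enveloping von Neumann algebra) of $E$. For $s\in G$ let $p_s\in A^{**}$ be the identity of $D_s^{**}\subset A^{**}$,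 regarded also as an element of $(A\rtimes_\alpha G)^{**}$, and let $m_s$ be the unique element of $p_s(A\rtimes_\alpha G)^{**}p_{s^{-1}}$ such that $a\,m_s=F(a,s)$ for $a\in D_s$ and $m_s\,b=F(\alpha_s(b),s)$ for $b\in D_{s^{-1}}$. Fix a partial action $\alpha$ of $G$ on $A$ and $s\in G$, and consider the conditions (i) $p_s\in M(A)$; (ii) $D_s=Ap_s$; (iii) $M(D_s)\subset M(A)$ (as subsets of $A^{**}$); (iv) $m_s\in M(A\rtimes_\alpha G)$. Then (i), (ii) and (iii) are equivalent, and they are implied by (iv). Moreover, if $p_s\in M(A)$ and $p_{s^{-1}}\in M(A)$, then (iv) holds. -/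

import Mathlib

noncomputable section

/-- The double dual of a complex normed space. -/
abbrev Bidual (E : Type*) [NormedAddCommGroup E] [NormedSpace ℂ E] : Type _ :=
  StrongDual ℂ (StrongDual ℂ E)

namespace Bidual

section Maps

variable {E F : Type*} [NormedAddCommGroup E] [NormedSpace ℂ E]
  [NormedAddCommGroup F] [NormedSpace ℂ F]

/-- The canonical embedding of `E` in `E**`. -/
def ofElem (a : E) : Bidual E := NormedSpace.inclusionInDoubleDual ℂ E a

/-- The double transpose `T** : E** → F**` of a bounded operator `T : E → F`. -/
def map (T : E →L[ℂ] F) (x : Bidual E) : Bidual F :=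
  x.comp ((ContinuousLinearMap.compL ℂ E F ℂ).flip T)

@[simp] lemma ofElem_apply (a : E) (φ : StrongDual ℂ E) : ofElem a φ = φ a := rfl

@[simp] lemma map_apply (T : E →L[ℂ] F) (x : Bidual E) (φ : StrongDual ℂ F) :
    map T x φ = x (φ.comp T) := rfl

end Maps

section Arens

variable {E : Type*} [NonUnitalNormedRing E] [NormedSpace ℂ E]
  [IsScalarTower ℂ E E] [SMulCommClass ℂ E E]

/-- For `φ ∈ E*`, the map `E → E*`, `a ↦ φ · a`, where `(φ · a)(b) = φ (a b)`. -/
def actRight : StrongDual ℂ E →L[ℂ] E →L[ℂ] StrongDual ℂ E :=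
  ((ContinuousLinearMap.compL ℂ E (E →L[ℂ] E) (StrongDual ℂ E)).flip
    (ContinuousLinearMap.mul ℂ E)).comp (ContinuousLinearMap.compL ℂ E E ℂ)

/-- For `y ∈ E**` and `φ ∈ E*`, the functional `y · φ ∈ E*`, `(y · φ)(a) = y (φ · a)`. -/
def actLeft (y : Bidual E) : StrongDual ℂ E →L[ℂ] StrongDual ℂ E :=
  (ContinuousLinearMap.compL ℂ E (StrongDual ℂ E) ℂ y).comp actRight

/-- The (first) Arens product on `E**`: `(x y)(φ) = x (y · φ)`. -/
def mul (x y : Bidual E) : Bidual E := x.comp (actLeft y)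

@[simp] lemma actRight_apply (φ : StrongDual ℂ E) (a b : E) : actRight φ a b = φ (a * b) := rfl

@[simp] lemma actLeft_apply (y : Bidual E) (φ : StrongDual ℂ E) (a : E) :
    actLeft y φ a = y (actRight φ a) := rfl

@[simp] lemma mul_apply (x y : Bidual E) (φ : StrongDual ℂ E) : mul x y φ = x (actLeft y φ) := rfl

end Arens

section One

variable {E : Type*} [NonUnitalCStarAlgebra E]

open Filter Topology

lemma exists_rotate (z : ℂ) : ∃ c : ℂ, ‖c‖ = 1 ∧ c * z = (‖z‖ : ℂ) := by
  by_cases hz : z = 0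
  · exact ⟨1, by simp, by simp [hz]⟩
  · have hz' : (‖z‖ : ℂ) ≠ 0 := by simpa using hz
    refine ⟨(‖z‖ : ℂ) / z, by simp [hz], by field_simp⟩

lemma norm_functional_sub_le (φ : StrongDual ℂ E) {t : ℝ} (ht : 0 < t) :
    ∃ b : E, ‖b‖ ≤ 1 ∧ ∀ x : E, ‖x‖ ≤ 1 → ‖star b - star b * x‖ ≤ t →
      ‖φ - actRight φ x‖ ≤ (1 + 3 * ‖φ‖) * t := by
  obtain ⟨b₀, hb₀, hb₀'⟩ : ∃ b : E, ‖b‖ ≤ 1 ∧ ‖φ‖ - t ^ 2 < ‖φ b‖ := by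
    by_contra! h
    have h0 : 0 ≤ ‖φ‖ - t ^ 2 := (norm_nonneg _).trans (h 0 (by simp))
    have := ContinuousLinearMap.opNorm_le_of_unit_norm (f := φ) h0 (fun x hx => h x hx.le)
    nlinarith [sq_pos_of_pos ht]
  obtain ⟨c, hc, hcb⟩ := exists_rotate (φ b₀)
  refine ⟨c • b₀, by simpa [norm_smul, hc] using hb₀, fun x hx hbx => ?_⟩
  set b := c • b₀ with hb
  have hb1 : ‖b‖ ≤ 1 := by simpa [hb, norm_smul, hc] using hb₀
  have hφb : φ b = (‖φ b₀‖ : ℂ) := by simp [hb, hcb]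
  refine ContinuousLinearMap.opNorm_le_of_unit_norm (by positivity) fun z₀ hz₀ => ?_
  obtain ⟨d, hd, hdz⟩ := exists_rotate ((φ - actRight φ x) z₀)
  set z := d • z₀ with hz
  have hz1 : ‖z‖ = 1 := by simp [hz, norm_smul, hd, hz₀]
  set w := z - x * z with hw
  have hφw : φ w = (‖(φ - actRight φ x) z₀‖ : ℂ) := by
    rw [← hdz, hw, hz]
    simp [mul_sub, mul_smul_comm]
  have hw2 : ‖w‖ ≤ 2 := by
    calc ‖w‖ ≤ ‖z‖ + ‖x * z‖ := norm_sub_le _ _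
      _ ≤ ‖z‖ + ‖x‖ * ‖z‖ := by gcongr; exact norm_mul_le _ _
      _ ≤ 2 := by rw [hz1]; linarith
  have hbw : ‖star b * w‖ ≤ t := by
    have : star b * w = (star b - star b * x) * z := by rw [hw, mul_sub, sub_mul, mul_assoc]
    rw [this]
    refine (norm_mul_le _ _).trans ?_
    rw [hz1, mul_one]; exact hbx
  have hwb : ‖star w * b‖ ≤ t := by
    rw [← norm_star, star_mul, star_star]; exact hbw
  set y := b + (t : ℂ) • w with hy
  have hyy : ‖y‖ ^ 2 ≤ 1 + 2 * t * t + 4 * t ^ 2 := by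
    have e : star y * y = star b * b + (t : ℂ) • (star b * w) + (t : ℂ) • (star w * b)
        + (t : ℂ) • (t : ℂ) • (star w * w) := by
      simp only [hy, star_add, star_smul, Complex.star_def, Complex.conj_ofReal, add_mul, mul_add,
        smul_mul_assoc, mul_smul_comm, smul_add]
      abel
    rw [sq, ← CStarRing.norm_star_mul_self, e]
    have h1 : ‖star b * b‖ ≤ 1 := by
      rw [CStarRing.norm_star_mul_self]; nlinarith [norm_nonneg b]
    have h2 : ‖star w * w‖ ≤ 4 := by
      rw [CStarRing.norm_star_mul_self]; nlinarith [norm_nonneg w]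
    have ht' : ‖(t : ℂ)‖ = t := by simp [abs_of_pos ht]
    calc _ ≤ ‖star b * b‖ + ‖(t : ℂ) • (star b * w)‖ + ‖(t : ℂ) • (star w * b)‖
        + ‖(t : ℂ) • (t : ℂ) • (star w * w)‖ := norm_add₄_le
      _ = ‖star b * b‖ + t * ‖star b * w‖ + t * ‖star w * b‖ + t * (t * ‖star w * w‖) := by
        simp only [norm_smul, ht']
      _ ≤ 1 + t * t + t * t + t * (t * 4) := by gcongr
      _ = _ := by ring
  have hy1 : ‖y‖ ≤ 1 + 3 * t ^ 2 := by
    refine le_of_sq_le_sq ?_ (by positivity)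
    nlinarith [sq_nonneg (t ^ 2)]
  have hφy : φ y = ((‖φ b₀‖ + t * ‖(φ - actRight φ x) z₀‖ : ℝ) : ℂ) := by
    simp [hy, hφb, hφw]
  have hle : ‖φ b₀‖ + t * ‖(φ - actRight φ x) z₀‖ ≤ ‖φ‖ * (1 + 3 * t ^ 2) := by
    have := (φ.le_opNorm y).trans (mul_le_mul_of_nonneg_left hy1 (norm_nonneg _))
    rw [hφy, Complex.norm_real] at this
    exact (le_abs_self _).trans this
  have : t * ‖(φ - actRight φ x) z₀‖ ≤ t * ((1 + 3 * ‖φ‖) * t) := by nlinarith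
  exact le_of_mul_le_mul_left this ht

variable (E) in
/-- The double dual of a C⋆-algebra has an identity. -/
theorem exists_one : ∃ e : Bidual E, ∀ x : Bidual E, mul e x = x ∧ mul x e = x := by
  let _ : PartialOrder E := CStarAlgebra.spectralOrder E
  have _ : StarOrderedRing E := CStarAlgebra.spectralOrderedRing E
  have hl := CStarAlgebra.increasingApproximateUnit E
  have _ := hl.neBot
  let u := Ultrafilter.of (CStarAlgebra.approximateUnit E)
  have hu : (u : Filter E) ≤ CStarAlgebra.approximateUnit E := Ultrafilter.of_le _
  have hconv : ∀ φ : StrongDual ℂ E,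
      Tendsto (fun x => actRight φ x) (CStarAlgebra.approximateUnit E) (𝓝 φ) := by
    intro φ
    rw [Metric.tendsto_nhds]
    intro ε hε
    have hpos : 0 < 1 + 3 * ‖φ‖ := by positivity
    obtain ⟨b, -, hb⟩ := norm_functional_sub_le φ (t := ε / 2 / (1 + 3 * ‖φ‖)) (by positivity)
    have h1 : ∀ᶠ x in CStarAlgebra.approximateUnit E, ‖x‖ ≤ 1 := hl.eventually_norm
    have h2 := Metric.tendsto_nhds.1 (hl.tendsto_mul_left (star b)) (ε / 2 / (1 + 3 * ‖φ‖))
      (by positivity)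
    filter_upwards [h1, h2] with x hx1 hx2
    rw [dist_comm, dist_eq_norm]
    rw [dist_comm, dist_eq_norm] at hx2
    have := hb x hx1 hx2.le
    rw [mul_div_cancel₀ _ hpos.ne'] at this
    linarith
  obtain ⟨e, he⟩ : ∃ e : Bidual E, ∀ φ : StrongDual ℂ E, Tendsto (fun x => φ x) u (𝓝 (e φ)) := by
    let i : E → WeakDual ℂ (StrongDual ℂ E) := fun a => StrongDual.toWeakDual (ofElem a)
    have hK := WeakDual.isCompact_closedBall (𝕜 := ℂ) (E := StrongDual ℂ E) 0 1
    have hmem : ∀ᶠ x in (u : Filter E), i x ∈ WeakDual.toStrongDual ⁻¹'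
        Metric.closedBall (0 : StrongDual ℂ (StrongDual ℂ E)) 1 := by
      filter_upwards [hu hl.eventually_norm] with x hx
      have h : ‖ofElem x‖ ≤ 1 := (NormedSpace.double_dual_bound ℂ E x).trans hx
      exact (dist_eq_norm (ofElem x) 0).trans_le ((congrArg norm (sub_zero (ofElem x))).trans_le h)
    obtain ⟨e, -, he⟩ := hK.ultrafilter_le_nhds (u.map i) (by
      rw [le_principal_iff]; exact hmem)
    refine ⟨WeakDual.toStrongDual e, fun φ => ?_⟩
    exact ((WeakDual.eval_continuous φ).tendsto e).comp (show Tendsto i u (𝓝 e) from he)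
  refine ⟨e, fun x => ⟨?_, ?_⟩⟩
  · ext φ
    refine tendsto_nhds_unique (he (actLeft x φ)) ?_
    exact (x.continuous.tendsto φ).comp ((hconv φ).mono_left hu)
  · ext φ
    have : actLeft e φ = φ := by
      ext a
      refine tendsto_nhds_unique (he (actRight φ a)) ?_
      exact (φ.continuous.tendsto a).comp ((hl.tendsto_mul_left a).mono_left hu)
    rw [mul_apply, this]

variable (E) in
/-- The identity of the double dual of a C⋆-algebra. -/
def one : Bidual E := (exists_one E).choose

lemma one_mul (x : Bidual E) : mul (one E) x = x := ((exists_one E).choose_spec x).1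

lemma mul_one (x : Bidual E) : mul x (one E) = x := ((exists_one E).choose_spec x).2

end One

end Bidual

/-- A C⋆-seminorm on a complex ⋆-algebra. -/
structure CStarSeminorm (L : Type*) [NonUnitalRing L] [Module ℂ L] [StarRing L] extends
    Seminorm ℂ L where
  mul_le : ∀ x y : L, toSeminorm (x * y) ≤ toSeminorm x * toSeminorm y
  star_mul_self : ∀ x : L, toSeminorm (star x * x) = toSeminorm x ^ 2

namespace CStarSeminorm

variable {L : Type*} [NonUnitalRing L] [Module ℂ L] [StarRing L]

lemma apply_star (p : CStarSeminorm L) (x : L) : p.toSeminorm (star x) = p.toSeminorm x := by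
  have key : ∀ y : L, p.toSeminorm y ≤ p.toSeminorm (star y) := by
    intro y
    have h := p.mul_le (star y) y
    rw [p.star_mul_self] at h
    rcases (apply_nonneg p.toSeminorm y).eq_or_lt with h0 | h0
    · rw [← h0]; exact apply_nonneg _ _
    · exact le_of_mul_le_mul_right (by rwa [sq] at h) h0
  refine le_antisymm ?_ (key x)
  simpa using key (star x)

/-- The ⋆-algebra `L`, endowed with the C⋆-seminorm `p`. -/
@[nolint unusedArguments]
def Pre (_ : CStarSeminorm L) : Type _ := L

variable (p : CStarSeminorm L)

instance : NonUnitalRing p.Pre := inferInstanceAs (NonUnitalRing L)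
instance : Module ℂ p.Pre := inferInstanceAs (Module ℂ L)
instance : StarRing p.Pre := inferInstanceAs (StarRing L)
instance [StarModule ℂ L] : StarModule ℂ p.Pre := inferInstanceAs (StarModule ℂ L)
instance [IsScalarTower ℂ L L] : IsScalarTower ℂ p.Pre p.Pre :=
  inferInstanceAs (IsScalarTower ℂ L L)
instance [SMulCommClass ℂ L L] : SMulCommClass ℂ p.Pre p.Pre :=
  inferInstanceAs (SMulCommClass ℂ L L)

instance : SeminormedAddCommGroup p.Pre :=
  { AddGroupSeminorm.toSeminormedAddCommGroup
      (show AddGroupSeminorm p.Pre from p.toSeminorm.toAddGroupSeminorm) with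
    toAddCommGroup := NonUnitalNonAssocRing.toAddCommGroup }

lemma norm_pre (x : p.Pre) : ‖x‖ = p.toSeminorm (show L from x) := rfl

instance : NonUnitalSeminormedRing p.Pre where
  dist_eq := SeminormedAddCommGroup.dist_eq
  norm_mul_le x y := p.mul_le x y

instance : NormedSpace ℂ p.Pre where
  norm_smul_le c x := (map_smul_eq_mul p.toSeminorm c (show L from x)).le

instance : NormedStarGroup p.Pre where
  norm_star_le x := (p.apply_star x).le

/-- The Hausdorff completion of `L` with respect to the C⋆-seminorm `p`. -/
def Completion : Type _ := UniformSpace.Completion p.Pre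

namespace Completion

open UniformSpace

instance : NormedAddCommGroup p.Completion :=
  inferInstanceAs (NormedAddCommGroup (UniformSpace.Completion p.Pre))
instance : NormedSpace ℂ p.Completion :=
  inferInstanceAs (NormedSpace ℂ (UniformSpace.Completion p.Pre))
instance : CompleteSpace p.Completion :=
  inferInstanceAs (CompleteSpace (UniformSpace.Completion p.Pre))

/-- The canonical map of `L` into its completion. -/
def of : L →ₗ[ℂ] p.Completion where
  toFun x := ((show p.Pre from x) : UniformSpace.Completion p.Pre)
  map_add' x y := UniformSpace.Completion.coe_add (α := p.Pre) x y
  map_smul' c x := UniformSpace.Completion.coe_smul c (show p.Pre from x)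

lemma norm_of (x : L) : ‖of p x‖ = p.toSeminorm x :=
  UniformSpace.Completion.norm_coe (show p.Pre from x)

lemma denseRange_of : DenseRange (of p) :=
  UniformSpace.Completion.denseRange_coe (α := p.Pre)

lemma isDenseInducing_of : IsDenseInducing (fun x : p.Pre => of p x) :=
  UniformSpace.Completion.isDenseInducing_coe (α := p.Pre)

/-- The multiplication of the completion: the continuous extension of that of `L`. -/
instance : Mul p.Completion where
  mul x y := ((isDenseInducing_of p).prodMap (isDenseInducing_of p)).extend
    (fun q : p.Pre × p.Pre => of p (q.1 * q.2)) (x, y)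

/-- The involution of the completion: the continuous extension of that of `L`. -/
instance : Star p.Completion where
  star x := UniformSpace.Completion.map (star : p.Pre → p.Pre) x

lemma continuous_of : Continuous (fun x : p.Pre => of p x) := (isDenseInducing_of p).continuous

lemma of_mul (x y : L) : of p (x * y) = of p x * of p y :=
  (((isDenseInducing_of p).prodMap (isDenseInducing_of p)).extend_eq
    (f := fun q : p.Pre × p.Pre => of p (q.1 * q.2))
    ((continuous_of p).comp continuous_mul) (x, y)).symm

lemma isometry_star_pre : Isometry (star : p.Pre → p.Pre) :=
  AddMonoidHomClass.isometry_of_norm (starAddEquiv : p.Pre ≃+ p.Pre) fun x => p.apply_star x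

lemma of_star (x : L) : of p (star x) = star (of p x) :=
  (UniformSpace.Completion.map_coe (isometry_star_pre p).uniformContinuous
    (show p.Pre from x)).symm

instance : ContinuousMul p.Completion where
  continuous_mul := by
    let t : p.Pre →+ p.Completion := (of p).toAddMonoidHom
    let m : p.Pre →+ p.Pre →+ p.Completion := (AddMonoidHom.mul : p.Pre →+ p.Pre →+ p.Pre).compr₂ t
    have hm : Continuous fun q : p.Pre × p.Pre => m q.1 q.2 := (continuous_of p).comp continuous_mul
    have di : IsDenseInducing t := isDenseInducing_of p
    exact (di.extend_Z_bilin di hm :)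

instance : ContinuousStar p.Completion where
  continuous_star := UniformSpace.Completion.continuous_map (f := (star : p.Pre → p.Pre))

lemma ind {P : p.Completion → Prop} (hP : IsClosed {x | P x}) (h : ∀ a, P (of p a)) (x) : P x :=
  UniformSpace.Completion.induction_on (α := p.Pre) x hP h

lemma ind₂ {P : p.Completion → p.Completion → Prop}
    (hP : IsClosed {x : p.Completion × p.Completion | P x.1 x.2})
    (h : ∀ a b, P (of p a) (of p b)) (x y) : P x y :=
  UniformSpace.Completion.induction_on₂ (α := p.Pre) (β := p.Pre) x y hP h

lemma ind₃ {P : p.Completion → p.Completion → p.Completion → Prop}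
    (hP : IsClosed {x : p.Completion × p.Completion × p.Completion | P x.1 x.2.1 x.2.2})
    (h : ∀ a b c, P (of p a) (of p b) (of p c)) (x y z) : P x y z :=
  UniformSpace.Completion.induction_on₃ (α := p.Pre) (β := p.Pre) (γ := p.Pre) x y z hP h

lemma left_distrib' (x y z : p.Completion) : x * (y + z) = x * y + x * z :=
  ind₃ p (P := fun x y z => x * (y + z) = x * y + x * z)
    (isClosed_eq (by fun_prop) (by fun_prop))
    (fun a b c => by simp only [← of_mul, ← map_add, mul_add]) x y z

lemma right_distrib' (x y z : p.Completion) : (x + y) * z = x * z + y * z :=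
  ind₃ p (P := fun x y z => (x + y) * z = x * z + y * z)
    (isClosed_eq (by fun_prop) (by fun_prop))
    (fun a b c => by simp only [← of_mul, ← map_add, add_mul]) x y z

lemma mul_assoc' (x y z : p.Completion) : x * y * z = x * (y * z) :=
  ind₃ p (P := fun x y z => x * y * z = x * (y * z))
    (isClosed_eq (by fun_prop) (by fun_prop))
    (fun a b c => by simp only [← of_mul, mul_assoc]) x y z

lemma norm_mul_le' (x y : p.Completion) : ‖x * y‖ ≤ ‖x‖ * ‖y‖ :=
  ind₂ p (P := fun x y => ‖x * y‖ ≤ ‖x‖ * ‖y‖)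
    (isClosed_le (by fun_prop) (by fun_prop))
    (fun a b => by rw [← of_mul, norm_of, norm_of, norm_of]; exact p.mul_le a b) x y

lemma star_star' (x : p.Completion) : star (star x) = x :=
  ind p (P := fun x => star (star x) = x) (isClosed_eq (by fun_prop) (by fun_prop))
    (fun a => by rw [← of_star, ← of_star, star_star]) x

lemma star_mul' (x y : p.Completion) : star (x * y) = star y * star x :=
  ind₂ p (P := fun x y => star (x * y) = star y * star x)
    (isClosed_eq (by fun_prop) (by fun_prop))
    (fun a b => by simp only [← of_mul, ← of_star, star_mul]) x y

lemma star_add' (x y : p.Completion) : star (x + y) = star x + star y :=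
  ind₂ p (P := fun x y => star (x + y) = star x + star y)
    (isClosed_eq (by fun_prop) (by fun_prop))
    (fun a b => by simp only [← of_star, ← map_add, star_add]) x y

lemma star_smul' [StarModule ℂ L] (c : ℂ) (x : p.Completion) : star (c • x) = star c • star x :=
  ind p (P := fun x => star (c • x) = star c • star x)
    (isClosed_eq (continuous_star.comp (continuous_const_smul c))
      ((continuous_const_smul (star c)).comp continuous_star))
    (fun a => by simp only [← of_star, ← map_smul, star_smul]) x

lemma norm_sq_le' (x : p.Completion) : ‖x‖ * ‖x‖ ≤ ‖star x * x‖ :=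
  ind p (P := fun x => ‖x‖ * ‖x‖ ≤ ‖star x * x‖)
    (isClosed_le (by fun_prop) (by fun_prop))
    (fun a => by rw [← of_star, ← of_mul, norm_of, norm_of, p.star_mul_self, sq]) x

lemma smul_mul' [IsScalarTower ℂ L L] (c : ℂ) (x y : p.Completion) : (c • x) * y = c • (x * y) :=
  ind₂ p (P := fun x y => (c • x) * y = c • (x * y))
    (isClosed_eq ((continuous_fst.const_smul c).mul continuous_snd)
      (continuous_mul.const_smul c))
    (fun a b => by simp only [← of_mul, ← map_smul, smul_mul_assoc]) x y

lemma mul_smul' [SMulCommClass ℂ L L] (c : ℂ) (x y : p.Completion) : x * (c • y) = c • (x * y) :=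
  ind₂ p (P := fun x y => x * (c • y) = c • (x * y))
    (isClosed_eq (continuous_fst.mul (continuous_snd.const_smul c))
      (continuous_mul.const_smul c))
    (fun a b => by simp only [← of_mul, ← map_smul, mul_smul_comm]) x y

instance : NonUnitalNormedRing p.Completion where
  dist_eq := NormedAddCommGroup.dist_eq
  left_distrib := left_distrib' p
  right_distrib := right_distrib' p
  mul_assoc := mul_assoc' p
  zero_mul x := by simpa using right_distrib' p 0 0 x
  mul_zero x := by simpa using left_distrib' p x 0 0
  norm_mul_le := norm_mul_le' p

instance : StarRing p.Completion where
  star_involutive := star_star' p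
  star_mul := star_mul' p
  star_add := star_add' p

/-- The completion of a complex ⋆-algebra with respect to a C⋆-seminorm is a C⋆-algebra. -/
instance [StarModule ℂ L] [IsScalarTower ℂ L L] [SMulCommClass ℂ L L] :
    NonUnitalCStarAlgebra p.Completion where
  __ := (inferInstance : NormedSpace ℂ p.Completion)
  norm_mul_self_le := norm_sq_le' p
  smul_assoc := smul_mul' p
  smul_comm c x y := (mul_smul' p c x y).symm
  star_smul := star_smul' p

end Completion

/-- A C⋆-seminorm on a C⋆-algebra is dominated by the norm. -/
lemma le_norm {A : Type*} [NonUnitalCStarAlgebra A] (p : CStarSeminorm A) (a : A) :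
    p.toSeminorm a ≤ ‖a‖ := by
  let f : A →⋆ₙₐ[ℂ] p.Completion :=
    { Completion.of p with
      map_zero' := map_zero (Completion.of p)
      map_mul' := Completion.of_mul p
      map_star' := Completion.of_star p }
  have h := NonUnitalStarAlgHom.norm_apply_le f a
  rwa [show f a = Completion.of p a from rfl, Completion.norm_of] at h

instance : Nonempty (CStarSeminorm L) :=
  ⟨{ toSeminorm := 0
     mul_le := fun x y => by simp
     star_mul_self := fun x => by simp }⟩

/-- The greatest C⋆-seminorm, the pointwise supremum of all of them, in case it is finite. -/
def greatest (h : ∀ x, BddAbove (Set.range fun p : CStarSeminorm L => p.toSeminorm x)) :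
    CStarSeminorm L where
  toFun x := ⨆ p : CStarSeminorm L, p.toSeminorm x
  map_zero' := by simp
  add_le' x y := ciSup_le fun p => (map_add_le_add p.toSeminorm x y).trans
    (add_le_add (le_ciSup (h x) p) (le_ciSup (h y) p))
  neg' x := by simp
  smul' c x := by simp only [map_smul_eq_mul]; rw [Real.mul_iSup_of_nonneg (norm_nonneg c)]
  mul_le x y := ciSup_le fun p => (p.mul_le x y).trans
    (mul_le_mul (le_ciSup (h x) p) (le_ciSup (h y) p) (apply_nonneg _ _)
      ((apply_nonneg p.toSeminorm x).trans (le_ciSup (h x) p)))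
  star_mul_self x := by
    show (⨆ p : CStarSeminorm L, p.toSeminorm (star x * x)) =
      (⨆ p : CStarSeminorm L, p.toSeminorm x) ^ 2
    simp only [CStarSeminorm.star_mul_self]
    refine le_antisymm (ciSup_le fun p => ?_) ?_
    · exact pow_le_pow_left₀ (apply_nonneg _ _) (le_ciSup (h x) p) 2
    · have hb : BddAbove (Set.range fun p : CStarSeminorm L => p.toSeminorm x ^ 2) := by
        simpa only [CStarSeminorm.star_mul_self] using h (star x * x)
      have h0 : 0 ≤ ⨆ p : CStarSeminorm L, p.toSeminorm x ^ 2 :=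
        Real.iSup_nonneg fun p => sq_nonneg _
      have : (⨆ p : CStarSeminorm L, p.toSeminorm x) ≤
          √(⨆ p : CStarSeminorm L, p.toSeminorm x ^ 2) :=
        ciSup_le fun p => Real.le_sqrt_of_sq_le (le_ciSup hb p)
      calc _ ≤ √(⨆ p : CStarSeminorm L, p.toSeminorm x ^ 2) ^ 2 :=
            pow_le_pow_left₀ (Real.iSup_nonneg fun p => apply_nonneg _ _) this 2
        _ = _ := Real.sq_sqrt h0

lemma le_greatest (h : ∀ x, BddAbove (Set.range fun p : CStarSeminorm L => p.toSeminorm x))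
    (p : CStarSeminorm L) (x : L) : p.toSeminorm x ≤ (greatest h).toSeminorm x :=
  le_ciSup (h x) p

end CStarSeminorm

/-- A partial action of a (discrete) group `G` on a C⋆-algebra `A`: closed two-sided ideals `D s`
and ⋆-isomorphisms `α s : D s⁻¹ → D s` such that `D 1 = A` and `α (s * t)` extends `α s ∘ α t`. -/
structure PartialAction (G A : Type*) [Group G] [NonUnitalCStarAlgebra A] where
  D : G → NonUnitalStarSubalgebra ℂ A
  isClosed_D : ∀ s, IsClosed (D s : Set A)
  mul_mem_left : ∀ s (a : A) {b : A}, b ∈ D s → a * b ∈ D s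
  mul_mem_right : ∀ s {a : A} (b : A), a ∈ D s → a * b ∈ D s
  α : ∀ s, D s⁻¹ ≃⋆ₐ[ℂ] D s
  D_one : D 1 = ⊤
  extends_comp : ∀ (s t : G) (a : D t⁻¹) (h : (α t a : A) ∈ D s⁻¹),
    ∃ h' : (a : A) ∈ D (s * t)⁻¹, (α (s * t) ⟨a, h'⟩ : A) = α s ⟨α t a, h⟩

namespace PartialAction

variable {G A : Type*} [Group G] [NonUnitalCStarAlgebra A] (α : PartialAction G A)

instance (s : G) : IsClosed (α.D s : Set A) := α.isClosed_D s

variable {α} in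
lemma D_congr {s t : G} (h : s = t) {a : A} (ha : a ∈ α.D s) : a ∈ α.D t := h ▸ ha

open Classical in
/-- `α s`, extended by zero to all of `A` (an auxiliary notion that avoids subtypes). -/
def act (s : G) (a : A) : A := if h : a ∈ α.D s⁻¹ then (α.α s ⟨a, h⟩ : A) else 0

lemma act_of_mem {s : G} {a : A} (h : a ∈ α.D s⁻¹) : α.act s a = (α.α s ⟨a, h⟩ : A) := dif_pos h

lemma act_coe {s : G} (a : α.D s⁻¹) : α.act s a = (α.α s a : A) := α.act_of_mem a.2

lemma act_mem {s : G} {a : A} (h : a ∈ α.D s⁻¹) : α.act s a ∈ α.D s := by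
  rw [act_of_mem α h]; exact (α.α s _).2

lemma act_act {s t : G} {a : A} (h : a ∈ α.D t⁻¹) (h' : α.act t a ∈ α.D s⁻¹) :
    a ∈ α.D (s * t)⁻¹ ∧ α.act (s * t) a = α.act s (α.act t a) := by
  have e := α.act_of_mem h
  obtain ⟨h1, h2⟩ := α.extends_comp s t ⟨a, h⟩ (e ▸ h')
  refine ⟨h1, ?_⟩
  rw [α.act_of_mem h1, h2, α.act_of_mem h']
  congr 3
  exact e.symm

lemma mem_one (a : A) : a ∈ α.D 1 := by rw [α.D_one]; trivial

lemma act_injOn {s : G} {a b : A} (ha : a ∈ α.D s⁻¹) (hb : b ∈ α.D s⁻¹)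
    (h : α.act s a = α.act s b) : a = b := by
  rw [α.act_of_mem ha, α.act_of_mem hb] at h
  exact congrArg Subtype.val ((α.α s).injective (Subtype.ext h))

lemma act_one (a : A) : α.act 1 a = a := by
  have m : ∀ b : A, b ∈ α.D (1 : G)⁻¹ := fun b => by rw [inv_one]; exact α.mem_one b
  refine α.act_injOn (m _) (m _) ?_
  have := (α.act_act (s := 1) (t := 1) (m a) (m _)).2
  rw [one_mul] at this
  exact this.symm

lemma act_inv_act {s : G} {a : A} (h : a ∈ α.D s⁻¹) : α.act s⁻¹ (α.act s a) = a := by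
  have h' : α.act s a ∈ α.D (s⁻¹)⁻¹ := by rw [inv_inv]; exact α.act_mem h
  have := (α.act_act h h').2
  rw [inv_mul_cancel, act_one] at this
  exact this.symm

lemma act_act_inv {s : G} {a : A} (h : a ∈ α.D s) : α.act s (α.act s⁻¹ a) = a := by
  have := α.act_inv_act (s := s⁻¹) (a := a) (by rwa [inv_inv])
  rwa [inv_inv] at this

lemma act_inv_mem {s : G} {a : A} (h : a ∈ α.D s) : α.act s⁻¹ a ∈ α.D s⁻¹ :=
  α.act_mem (by rwa [inv_inv])

lemma coe_symm {s : G} (a : α.D s) : ((α.α s).symm a : A) = α.act s⁻¹ a := by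
  refine α.act_injOn (s := s) ((α.α s).symm a).2 (α.act_inv_mem a.2) ?_
  rw [α.act_act_inv a.2, act_coe, StarAlgEquiv.apply_symm_apply]

lemma act_mul {s : G} {a b : A} (ha : a ∈ α.D s⁻¹) (hb : b ∈ α.D s⁻¹) :
    α.act s (a * b) = α.act s a * α.act s b := by
  rw [α.act_of_mem ha, α.act_of_mem hb, α.act_of_mem (mul_mem ha hb)]
  exact congrArg Subtype.val (map_mul (α.α s) ⟨a, ha⟩ ⟨b, hb⟩)

lemma act_add {s : G} {a b : A} (ha : a ∈ α.D s⁻¹) (hb : b ∈ α.D s⁻¹) :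
    α.act s (a + b) = α.act s a + α.act s b := by
  rw [α.act_of_mem ha, α.act_of_mem hb, α.act_of_mem (add_mem ha hb)]
  exact congrArg Subtype.val (map_add (α.α s) ⟨a, ha⟩ ⟨b, hb⟩)

lemma act_smul {s : G} (c : ℂ) {a : A} (ha : a ∈ α.D s⁻¹) :
    α.act s (c • a) = c • α.act s a := by
  rw [α.act_of_mem ha, α.act_of_mem (SMulMemClass.smul_mem c ha)]
  exact congrArg Subtype.val (map_smul (α.α s) c ⟨a, ha⟩)

lemma act_star {s : G} {a : A} (ha : a ∈ α.D s⁻¹) : α.act s (star a) = star (α.act s a) := by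
  rw [α.act_of_mem ha, α.act_of_mem (star_mem ha)]
  exact congrArg Subtype.val (map_star (α.α s) ⟨a, ha⟩)

lemma act_mem_mul {s t : G} {a : A} (ha : a ∈ α.D s⁻¹) (ha' : a ∈ α.D t) :
    α.act s a ∈ α.D (s * t) := by
  have h1 : α.act s a ∈ α.D (s⁻¹)⁻¹ := by rw [inv_inv]; exact α.act_mem ha
  have h2 : α.act s⁻¹ (α.act s a) ∈ α.D (t⁻¹)⁻¹ := by rw [inv_inv, α.act_inv_act ha]; exact ha'
  have := (α.act_act h1 h2).1
  simpa using this

lemma act_mul_act {s t : G} {a : A} (ha : a ∈ α.D t⁻¹) (ha' : a ∈ α.D (s * t)⁻¹) :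
    α.act (s * t) a = α.act s (α.act t a) := by
  refine (α.act_act ha ?_).2
  have := α.act_mem_mul ha ha'
  simpa using this

/-- Every element of an ideal `D s` is a sum of products of two of its elements. -/
lemma mul_induction {s : G} {P : A → Prop} (h0 : P 0)
    (hadd : ∀ x y, x ∈ α.D s → y ∈ α.D s → P x → P y → P (x + y))
    (hsmul : ∀ (c : ℂ) x, x ∈ α.D s → P x → P (c • x))
    (hmul : ∀ x y, x ∈ α.D s → y ∈ α.D s → P (x * y)) {a : A} (ha : a ∈ α.D s) : P a := by
  let _ : PartialOrder (α.D s) := CStarAlgebra.spectralOrder _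
  have _ : StarOrderedRing (α.D s) := CStarAlgebra.spectralOrderedRing _
  have key : ∀ b : α.D s, P b := by
    intro b
    have hb : b ∈ Submodule.span ℂ {a : α.D s | 0 ≤ a} := by
      rw [CStarAlgebra.span_nonneg]; trivial
    induction hb using Submodule.span_induction with
    | mem x hx =>
      have := CFC.sqrt_mul_sqrt_self x hx
      rw [← this]
      exact hmul _ _ (CFC.sqrt x).2 (CFC.sqrt x).2
    | zero => exact h0
    | add x y _ _ hx hy => exact hadd _ _ x.2 y.2 hx hy
    | smul c x _ hx => exact hsmul c _ x.2 hx
  exact key ⟨a, ha⟩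

lemma act_mul_assoc {s : G} (x c : A) {b : A} (hb : b ∈ α.D s) :
    α.act s (α.act s⁻¹ (x * b) * c) = x * α.act s (α.act s⁻¹ b * c) := by
  have m1 : ∀ {y}, y ∈ α.D s → y ∈ α.D (s⁻¹)⁻¹ := fun h => by rwa [inv_inv]
  have m2 : ∀ {y}, y ∈ α.D s → α.act s⁻¹ y * c ∈ α.D s⁻¹ :=
    fun h => α.mul_mem_right _ c (α.act_inv_mem h)
  have m3 : ∀ {y}, y ∈ α.D s → x * y ∈ α.D s := fun h => α.mul_mem_left _ x h
  refine α.mul_induction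
    (P := fun b => α.act s (α.act s⁻¹ (x * b) * c) = x * α.act s (α.act s⁻¹ b * c))
    ?_ ?_ ?_ ?_ hb
  · have z : ∀ r : G, α.act r 0 = 0 := fun r => by
      simpa using α.act_smul (s := r) 0 (zero_mem (α.D r⁻¹))
    simp [z]
  · intro y z hy hz ihy ihz
    rw [mul_add, α.act_add (m1 (m3 hy)) (m1 (m3 hz)), add_mul, α.act_add (m2 (m3 hy)) (m2 (m3 hz)),
      ihy, ihz, α.act_add (m1 hy) (m1 hz), add_mul, α.act_add (m2 hy) (m2 hz), mul_add]
  · intro r y hy ih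
    rw [mul_smul_comm, α.act_smul _ (m1 (m3 hy)), smul_mul_assoc, α.act_smul _ (m2 (m3 hy)), ih,
      α.act_smul _ (m1 hy), smul_mul_assoc, α.act_smul _ (m2 hy), mul_smul_comm]
  · intro y z hy hz
    rw [← mul_assoc, α.act_mul (m1 (m3 hy)) (m1 hz), mul_assoc,
      α.act_mul (α.act_inv_mem (m3 hy)) (m2 hz), α.act_act_inv (m3 hy),
      α.act_mul (m1 hy) (m1 hz), mul_assoc (α.act s⁻¹ y),
      α.act_mul (α.act_inv_mem hy) (m2 hz), α.act_act_inv hy, mul_assoc]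

lemma act_mul_inv_act {s t : G} {y : A} (h1 : y ∈ α.D s⁻¹) (h2 : y ∈ α.D t) :
    α.act (s * t)⁻¹ (α.act s y) = α.act t⁻¹ y := by
  have h3 : α.act s y ∈ α.D (s⁻¹)⁻¹ := by rw [inv_inv]; exact α.act_mem h1
  have h4 : α.act s⁻¹ (α.act s y) ∈ α.D (t⁻¹)⁻¹ := by
    rw [α.act_inv_act h1, inv_inv]; exact h2
  rw [mul_inv_rev, (α.act_act h3 h4).2, α.act_inv_act h1]

/-- The product in `D (s * t)` of `a ∈ D s` and `b ∈ D t`, namely `α_s (α_s⁻¹ (a) b)`. -/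
def mulD {s t : G} (a : α.D s) (b : α.D t) : α.D (s * t) :=
  ⟨(α.α s ⟨(α.α s).symm a * b, α.mul_mem_right _ _ ((α.α s).symm a).2⟩ : A), by
    rw [← act_coe]
    exact α.act_mem_mul (α.mul_mem_right _ _ ((α.α s).symm a).2) (α.mul_mem_left _ _ b.2)⟩

/-- The adjoint in `D s⁻¹` of `a ∈ D s`, namely `α_s⁻¹ (a*)`. -/
def starD {s : G} (a : α.D s) : α.D s⁻¹ := (α.α s).symm (star a)

lemma coe_mulD {s t : G} (a : α.D s) (b : α.D t) :
    (α.mulD a b : A) = α.act s (α.act s⁻¹ a * b) := by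
  rw [← coe_symm]
  exact (α.act_coe ⟨_, α.mul_mem_right _ _ ((α.α s).symm a).2⟩).symm

lemma coe_starD {s : G} (a : α.D s) : (α.starD a : A) = α.act s⁻¹ (star a) := α.coe_symm _

lemma mulD_mem {s t : G} (a : α.D s) (b : α.D t) : α.act s⁻¹ a * b ∈ α.D s⁻¹ :=
  α.mul_mem_right _ _ (α.act_inv_mem a.2)

lemma mulD_assoc {r s t : G} (a : α.D r) (b : α.D s) (c : α.D t) :
    (α.mulD (α.mulD a b) c : A) = α.mulD a (α.mulD b c) := by
  simp only [coe_mulD]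
  have hx : α.act r⁻¹ a ∈ α.D r⁻¹ := α.act_inv_mem a.2
  have h1 : α.act r⁻¹ a * b ∈ α.D r⁻¹ := α.mulD_mem a b
  have h2 : α.act r⁻¹ a * b ∈ α.D s := α.mul_mem_left _ _ b.2
  rw [α.act_mul_inv_act h1 h2, ← α.act_mul_assoc _ _ b.2]
  have h5 : α.act s⁻¹ (α.act r⁻¹ a * b) ∈ α.D s⁻¹ := α.act_inv_mem h2
  have h6 : α.act s⁻¹ (α.act r⁻¹ a * b) ∈ α.D (s⁻¹ * r⁻¹) :=
    α.act_mem_mul (by rwa [inv_inv]) h1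
  exact α.act_mul_act (α.mul_mem_right _ _ h5) (α.mul_mem_right _ _ (by rwa [mul_inv_rev]))

lemma starD_starD {s : G} (a : α.D s) : (α.starD (α.starD a) : A) = a := by
  rw [coe_starD, coe_starD, inv_inv, α.act_star (α.act_inv_mem (star_mem a.2)),
    α.act_act_inv (star_mem a.2), star_star]

lemma starD_mulD {s t : G} (a : α.D s) (b : α.D t) :
    (α.starD (α.mulD a b) : A) = α.mulD (α.starD b) (α.starD a) := by
  have h1 : α.act s⁻¹ a * b ∈ α.D s⁻¹ := α.mulD_mem a b
  have h2 : α.act s⁻¹ a * b ∈ α.D t := α.mul_mem_left _ _ b.2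
  simp only [coe_mulD, coe_starD]
  rw [← α.act_star h1, α.act_mul_inv_act (star_mem h1) (star_mem h2), inv_inv,
    α.act_act_inv (star_mem b.2), star_mul, α.act_star (a := (a : A)) (by rw [inv_inv]; exact a.2)]

/-- The vector space `L_c` of finitely supported functions `f` on `G` with `f s ∈ D s`. -/
def Lc : Type _ := DirectSum G fun s => α.D s

namespace Lc

instance : AddCommGroup α.Lc := inferInstanceAs (AddCommGroup (DirectSum G fun s => α.D s))
instance : Module ℂ α.Lc := inferInstanceAs (Module ℂ (DirectSum G fun s => α.D s))

open Classical in
/-- `F s a` is the function with value `a ∈ D s` at `s` and `0` elsewhere. -/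
def F (s : G) : α.D s →ₗ[ℂ] α.Lc := DirectSum.lof ℂ G (fun s => α.D s) s

open Classical in
/-- The additive map on `L_c` with prescribed values on the functions `F s a`. -/
def lift {M : Type*} [AddCommMonoid M] (f : ∀ s, α.D s →+ M) : α.Lc →+ M :=
  DirectSum.toAddMonoid f

lemma lift_F {M : Type*} [AddCommMonoid M] (f : ∀ s, α.D s →+ M) (s : G) (a : α.D s) :
    lift α f (F α s a) = f s a := by
  classical
  exact DirectSum.toAddMonoid_of f s a

lemma F_congr {s t : G} (h : s = t) {a : α.D s} {b : α.D t} (hab : (a : A) = b) :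
    F α s a = F α t b := by
  subst h
  rw [Subtype.ext hab]

/-- `mulD` as a biadditive map. -/
def mulDHom (s t : G) : α.D s →+ α.D t →+ α.D (s * t) :=
  AddMonoidHom.mk' (fun a => AddMonoidHom.mk' (fun b => α.mulD a b) fun b b' => by
      apply Subtype.ext
      simp only [AddMemClass.coe_add, coe_mulD]
      rw [mul_add, α.act_add (α.mulD_mem a b) (α.mulD_mem a b')]) fun a a' => by
    ext b
    simp only [AddMonoidHom.mk'_apply, AddMonoidHom.add_apply, AddMemClass.coe_add, coe_mulD]
    rw [α.act_add (by rw [inv_inv]; exact a.2) (by rw [inv_inv]; exact a'.2), add_mul,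
      α.act_add (α.mulD_mem a b) (α.mulD_mem a' b)]

/-- `starD` as an additive map. -/
def starDHom (s : G) : α.D s →+ α.D s⁻¹ :=
  AddMonoidHom.mk' (fun a => α.starD a) fun a b => by
    simp [starD]

/-- The biadditive extension of `F(a,s) F(b,t) = F(α_s(α_s⁻¹(a) b), s t)`. -/
def mulHom : α.Lc →+ α.Lc →+ α.Lc :=
  lift α fun s => AddMonoidHom.flip <| lift α fun t =>
    AddMonoidHom.flip <| (mulDHom α s t).compr₂ (F α (s * t)).toAddMonoidHom

/-- The additive extension of `F(a,s)* = F(α_s⁻¹(a*), s⁻¹)`. -/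
def starHom : α.Lc →+ α.Lc :=
  lift α fun s => (F α s⁻¹).toAddMonoidHom.comp (starDHom α s)

instance : Mul α.Lc := ⟨fun x y => mulHom α x y⟩

instance : Star α.Lc := ⟨starHom α⟩

lemma F_mul_F {s t : G} (a : α.D s) (b : α.D t) :
    F α s a * F α t b = F α (s * t) (α.mulD a b) := by
  show mulHom α (F α s a) (F α t b) = _
  rw [mulHom, lift_F, AddMonoidHom.flip_apply, lift_F]
  rfl

lemma star_F {s : G} (a : α.D s) : star (F α s a) = F α s⁻¹ (α.starD a) := by
  show starHom α (F α s a) = _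
  rw [starHom, lift_F]
  rfl

@[elab_as_elim]
lemma ind {P : α.Lc → Prop} (x : α.Lc) (h0 : P 0) (hF : ∀ s a, P (F α s a))
    (hadd : ∀ x y, P x → P y → P (x + y)) : P x := by
  classical
  exact DirectSum.induction_on x h0 hF hadd

lemma add_mul' (x y z : α.Lc) : (x + y) * z = x * z + y * z := by
  show mulHom α (x + y) z = _
  rw [map_add]; rfl

lemma mul_add' (x y z : α.Lc) : x * (y + z) = x * y + x * z :=
  map_add (mulHom α x) y z

lemma zero_mul' (x : α.Lc) : 0 * x = 0 := by
  show mulHom α 0 x = _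
  rw [map_zero]; rfl

lemma mul_zero' (x : α.Lc) : x * 0 = 0 := map_zero (mulHom α x)

instance : NonUnitalRing α.Lc where
  left_distrib := mul_add' α
  right_distrib := add_mul' α
  zero_mul := zero_mul' α
  mul_zero := mul_zero' α
  mul_assoc x y z := by
    induction x using ind with
    | h0 => simp only [zero_mul']
    | hadd x x' hx hx' => simp only [add_mul', hx, hx']
    | hF r a =>
    induction y using ind with
    | h0 => simp only [zero_mul', mul_zero']
    | hadd x x' hx hx' => simp only [add_mul', mul_add', hx, hx']
    | hF s b =>
    induction z using ind with
    | h0 => simp only [mul_zero']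
    | hadd x x' hx hx' => simp only [mul_add', hx, hx']
    | hF t c =>
      rw [F_mul_F, F_mul_F, F_mul_F, F_mul_F]
      exact F_congr α (mul_assoc r s t) (α.mulD_assoc a b c)

instance : StarRing α.Lc where
  star_add x y := map_add (starHom α) x y
  star_involutive x := by
    have h0 : star (0 : α.Lc) = 0 := map_zero (starHom α)
    have ha : ∀ x y : α.Lc, star (x + y) = star x + star y := map_add (starHom α)
    induction x using ind with
    | h0 => rw [h0, h0]
    | hadd x y hx hy => rw [ha, ha, hx, hy]
    | hF s a =>
      rw [star_F, star_F]
      exact F_congr α (inv_inv s) (α.starD_starD a)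
  star_mul x y := by
    have h0 : star (0 : α.Lc) = 0 := map_zero (starHom α)
    have ha : ∀ x y : α.Lc, star (x + y) = star x + star y := map_add (starHom α)
    induction x using ind with
    | h0 => rw [h0, zero_mul, mul_zero, h0]
    | hadd x x' hx hx' => rw [ha, add_mul, mul_add, ha, hx, hx']
    | hF s a =>
    induction y using ind with
    | h0 => rw [h0, zero_mul, mul_zero, h0]
    | hadd x x' hx hx' => rw [ha, mul_add, add_mul, ha, hx, hx']
    | hF t b =>
      rw [F_mul_F, star_F, star_F, star_F, F_mul_F]
      exact F_congr α (mul_inv_rev s t) (α.starD_mulD a b)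

instance : IsScalarTower ℂ α.Lc α.Lc where
  smul_assoc c x y := by
    simp only [smul_eq_mul]
    induction x using ind with
    | h0 => simp
    | hadd x x' hx hx' => rw [smul_add, add_mul, add_mul, smul_add, hx, hx']
    | hF s a =>
    induction y using ind with
    | h0 => simp
    | hadd x x' hx hx' => rw [mul_add, mul_add, smul_add, hx, hx']
    | hF t b =>
      rw [← map_smul, F_mul_F, F_mul_F, ← map_smul]
      refine congrArg _ (Subtype.ext ?_)
      simp only [coe_mulD, SetLike.val_smul]
      rw [α.act_smul c (by rw [inv_inv]; exact a.2), smul_mul_assoc,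
        α.act_smul c (α.mulD_mem a b)]

instance : SMulCommClass ℂ α.Lc α.Lc where
  smul_comm c x y := by
    simp only [smul_eq_mul]
    induction x using ind with
    | h0 => simp
    | hadd x x' hx hx' => rw [add_mul, add_mul, smul_add, hx, hx']
    | hF s a =>
    induction y using ind with
    | h0 => simp
    | hadd x x' hx hx' => rw [smul_add, mul_add, mul_add, smul_add, hx, hx']
    | hF t b =>
      rw [← map_smul, F_mul_F, F_mul_F, ← map_smul]
      refine congrArg _ (Subtype.ext ?_)
      simp only [coe_mulD, SetLike.val_smul]
      rw [mul_smul_comm, α.act_smul c (α.mulD_mem a b)]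

instance : StarModule ℂ α.Lc where
  star_smul c x := by
    induction x using ind with
    | h0 => simp
    | hadd x y hx hy => rw [smul_add, star_add, star_add, smul_add, hx, hy]
    | hF s a =>
      rw [← map_smul, star_F, star_F, ← map_smul]
      refine congrArg _ (Subtype.ext ?_)
      simp only [coe_starD, SetLike.val_smul, star_smul]
      rw [α.act_smul _ (by rw [inv_inv]; exact star_mem a.2)]

end Lc

end PartialAction

namespace PartialAction

open Bidual

variable {G A : Type*} [Group G] [NonUnitalCStarAlgebra A] (α : PartialAction G A)

/-- The inclusion of the ideal `D s` in `A`. -/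
def incl (s : G) : α.D s →L[ℂ] A where
  toFun a := a
  map_add' _ _ := rfl
  map_smul' _ _ := rfl
  cont := continuous_subtype_val

namespace Lc

/-- The embedding `a ↦ F(a, e)` of `A` in `L_c`. -/
def ofA : A →ₗ[ℂ] α.Lc where
  toFun a := F α 1 ⟨a, α.mem_one a⟩
  map_add' a b := (map_add (F α 1) ⟨a, α.mem_one a⟩ ⟨b, α.mem_one b⟩ :)
  map_smul' c a := (map_smul (F α 1) c ⟨a, α.mem_one a⟩ :)

lemma ofA_apply (a : A) : ofA α a = F α 1 ⟨a, α.mem_one a⟩ := rfl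

lemma ofA_mul_F (a : A) {s : G} (b : α.D s) :
    ofA α a * F α s b = F α s ⟨a * b, α.mul_mem_left _ _ b.2⟩ := by
  rw [ofA_apply, F_mul_F]
  refine F_congr α (one_mul s) ?_
  rw [coe_mulD, inv_one, act_one, act_one]

lemma F_mul_ofA {s : G} (a : α.D s) (b : A) :
    F α s a * ofA α b
      = F α s (α.α s ⟨(α.α s).symm a * b, α.mul_mem_right _ _ ((α.α s).symm a).2⟩) := by
  rw [ofA_apply, F_mul_F]
  exact F_congr α (mul_one s) rfl

lemma ofA_mul (a b : A) : ofA α (a * b) = ofA α a * ofA α b := by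
  rw [ofA_apply α b, ofA_mul_F]; rfl

lemma ofA_star (a : A) : ofA α (star a) = star (ofA α a) := by
  rw [ofA_apply, ofA_apply, star_F]
  refine F_congr α inv_one.symm ?_
  rw [coe_starD, inv_one, act_one]

lemma star_F_mul_F {s : G} (a : α.D s) :
    star (F α s a) * F α s a = ofA α ((α.α s).symm (star a * a)) := by
  rw [star_F, F_mul_F, ofA_apply]
  refine F_congr α (inv_mul_cancel s) ?_
  rw [coe_mulD, coe_symm, coe_starD, inv_inv, α.act_act_inv (star_mem a.2)]
  rfl

lemma seminorm_F_le (p : CStarSeminorm α.Lc) {s : G} (a : α.D s) :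
    p.toSeminorm (F α s a) ≤ ‖a‖ := by
  let q : CStarSeminorm A :=
    { toSeminorm := p.toSeminorm.comp (ofA α)
      mul_le := fun x y => by
        simp only [Seminorm.comp_apply, ofA_mul]; exact p.mul_le _ _
      star_mul_self := fun x => by
        simp only [Seminorm.comp_apply, ofA_mul, ofA_star]; exact p.star_mul_self _ }
  have h1 : p.toSeminorm (F α s a) ^ 2 ≤ ‖a‖ ^ 2 := by
    rw [← p.star_mul_self, star_F_mul_F]
    calc _ ≤ ‖((α.α s).symm (star a * a) : A)‖ := q.le_norm _
      _ = ‖(α.α s).symm (star a * a)‖ := rfl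
      _ ≤ ‖star a * a‖ := NonUnitalStarAlgHom.norm_apply_le (α.α s).symm _
      _ = ‖a‖ ^ 2 := by rw [CStarRing.norm_star_mul_self, sq]
  exact le_of_sq_le_sq h1 (norm_nonneg _)

/-- The greatest C⋆-seminorm on `L_c` is finite. -/
lemma bddAbove (x : α.Lc) :
    BddAbove (Set.range fun p : CStarSeminorm α.Lc => p.toSeminorm x) := by
  induction x using ind with
  | h0 => exact ⟨0, by rintro _ ⟨p, rfl⟩; simp⟩
  | hF s a => exact ⟨‖a‖, by rintro _ ⟨p, rfl⟩; exact seminorm_F_le α p a⟩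
  | hadd x y hx hy =>
    obtain ⟨c, hc⟩ := hx
    obtain ⟨d, hd⟩ := hy
    refine ⟨c + d, ?_⟩
    rintro _ ⟨p, rfl⟩
    exact (map_add_le_add p.toSeminorm x y).trans (add_le_add (hc ⟨p, rfl⟩) (hd ⟨p, rfl⟩))

end Lc

/-- The crossed product `A ⋊_α G`: the completion of the ⋆-algebra `L_c` in its greatest
C⋆-seminorm. -/
abbrev CrossedProduct : Type _ := (CStarSeminorm.greatest (Lc.bddAbove α)).Completion

/-- The element `F(a, s)` of the crossed product, for `a ∈ D s`. -/
def F (s : G) : α.D s →L[ℂ] α.CrossedProduct :=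
  LinearMap.mkContinuous ((CStarSeminorm.Completion.of _).comp (Lc.F α s)) 1 fun a => by
    rw [_root_.one_mul]
    exact (CStarSeminorm.Completion.norm_of _ _).trans_le (Lc.seminorm_F_le α _ a)

/-- The canonical map `a ↦ F(a, e)` of `A` into the crossed product. -/
def ofA : A →L[ℂ] α.CrossedProduct :=
  LinearMap.mkContinuous ((CStarSeminorm.Completion.of _).comp (Lc.ofA α)) 1 fun a => by
    rw [_root_.one_mul]
    exact (CStarSeminorm.Completion.norm_of _ _).trans_le (Lc.seminorm_F_le α _ _)

lemma F_apply (s : G) (a : α.D s) :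
    α.F s a = CStarSeminorm.Completion.of _ (Lc.F α s a) := rfl

lemma ofA_apply (a : A) : α.ofA a = CStarSeminorm.Completion.of _ (Lc.ofA α a) := rfl

lemma ofA_mul_F (a : A) {s : G} (b : α.D s) :
    α.ofA a * α.F s b = α.F s ⟨a * b, α.mul_mem_left _ _ b.2⟩ := by
  rw [F_apply, F_apply, ofA_apply, ← CStarSeminorm.Completion.of_mul, Lc.ofA_mul_F]

lemma F_mul_ofA {s : G} (a : α.D s) (b : A) :
    α.F s a * α.ofA b
      = α.F s (α.α s ⟨(α.α s).symm a * b, α.mul_mem_right _ _ ((α.α s).symm a).2⟩) := by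
  rw [F_apply, F_apply, ofA_apply, ← CStarSeminorm.Completion.of_mul, Lc.F_mul_ofA]

/-- The projection `p_s ∈ A**`: the identity of `D_s**`, regarded as an element of `A**`. -/
def p (s : G) : Bidual A := Bidual.map (α.incl s) (Bidual.one (α.D s))

/-- The projection `p_s`, regarded as an element of `(A ⋊_α G)**`. -/
def pCross (s : G) : Bidual α.CrossedProduct := Bidual.map α.ofA (α.p s)

/-- The defining property of the element `m_s` of `p_s (A ⋊_α G)** p_{s⁻¹}`, which is the multiplier
of the `D_s - D_{s⁻¹}` imprimitivity bimodule `X_s = {F(a, s) | a ∈ D_s}` given by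
`a · m_s = F(a, s)` for `a ∈ D_s` and `m_s · b = F(α_s(b), s)` for `b ∈ D_{s⁻¹}`. -/
structure IsM (s : G) (m : Bidual α.CrossedProduct) : Prop where
  left : Bidual.mul (α.pCross s) m = m
  right : Bidual.mul m (α.pCross s⁻¹) = m
  mul_left : ∀ a : α.D s, Bidual.mul (ofElem (α.ofA a)) m = ofElem (α.F s a)
  mul_right : ∀ b : α.D s⁻¹, Bidual.mul m (ofElem (α.ofA b)) = ofElem (α.F s (α.α s b))

lemma one_actRight {E : Type*} [NonUnitalCStarAlgebra E] (φ : StrongDual ℂ E) (a : E) :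
    Bidual.one E (actRight φ a) = φ a := by
  have := congrArg (fun x : Bidual E => x φ) (Bidual.mul_one (ofElem a))
  exact this

lemma isM_unique {s : G} {m : Bidual α.CrossedProduct} (h : α.IsM s m) :
    m = Bidual.map (α.F s) (Bidual.one (α.D s)) := by
  ext φ
  conv_lhs => rw [← h.left]
  show Bidual.one (α.D s) (((actLeft m φ).comp α.ofA).comp (α.incl s)) = _
  rw [Bidual.map_apply]
  congr 1
  ext a
  exact congrArg (fun x : Bidual α.CrossedProduct => x φ) (h.mul_left a)

lemma isM_map (s : G) : α.IsM s (Bidual.map (α.F s) (Bidual.one (α.D s))) := by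
  have hl : ∀ a : α.D s, Bidual.mul (ofElem (α.ofA a)) (Bidual.map (α.F s) (Bidual.one (α.D s)))
      = ofElem (α.F s a) := by
    intro a
    ext φ
    show Bidual.one (α.D s) ((actRight φ (α.ofA a)).comp (α.F s)) = φ (α.F s a)
    rw [show (actRight φ (α.ofA a)).comp (α.F s) = actRight (φ.comp (α.F s)) a from ?_,
      one_actRight]
    · rfl
    · ext b
      exact congrArg φ (α.ofA_mul_F a b)
  refine ⟨?_, ?_, hl, ?_⟩
  · ext φ
    show Bidual.one (α.D s) (((actLeft _ φ).comp α.ofA).comp (α.incl s)) = _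
    rw [Bidual.map_apply]
    congr 1
    ext a
    exact congrArg (fun x : Bidual α.CrossedProduct => x φ) (hl a)
  · ext φ
    rw [mul_apply, Bidual.map_apply, Bidual.map_apply]
    congr 1
    ext a
    show Bidual.one (α.D s⁻¹) (((actRight φ (α.F s a)).comp α.ofA).comp (α.incl s⁻¹)) = φ (α.F s a)
    let T : α.D s⁻¹ →L[ℂ] α.D s :=
      LinearMap.mkContinuous (LinearMapClass.linearMap (α.α s)) 1 fun b => by
        rw [_root_.one_mul]; exact NonUnitalStarAlgHom.norm_apply_le (α.α s) b
    have e : ((actRight φ (α.F s a)).comp α.ofA).comp (α.incl s⁻¹)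
        = actRight ((φ.comp (α.F s)).comp T) ((α.α s).symm a) := by
      ext b
      exact congrArg φ (α.F_mul_ofA a b)
    rw [e, one_actRight]
    exact congrArg (fun y => φ (α.F s y)) ((α.α s).apply_symm_apply a)
  · intro b
    ext φ
    show Bidual.one (α.D s) ((actLeft (ofElem (α.ofA b)) φ).comp (α.F s)) = φ (α.F s (α.α s b))
    have e : (actLeft (ofElem (α.ofA (b : A))) φ).comp (α.F s)
        = actLeft (ofElem (α.α s b)) (φ.comp (α.F s)) := by
      ext a
      show φ (α.F s a * α.ofA b) = φ (α.F s (a * α.α s b))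
      rw [F_mul_ofA]
      refine congrArg (fun y => φ (α.F s y)) ?_
      have : (⟨(α.α s).symm a * b, α.mul_mem_right _ _ ((α.α s).symm a).2⟩ : α.D s⁻¹)
        = (α.α s).symm a * b := rfl
      rw [this, map_mul, StarAlgEquiv.apply_symm_apply]
    rw [e]
    exact congrArg (fun x : Bidual (α.D s) => x (φ.comp (α.F s)))
      (Bidual.one_mul (ofElem (α.α s b)))

theorem existsUnique_m (s : G) : ∃! m, α.IsM s m :=
  ⟨_, α.isM_map s, fun _ h => α.isM_unique h⟩

/-- The element `m_s` of `(A ⋊_α G)**`. -/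
def m (s : G) : Bidual α.CrossedProduct := (α.existsUnique_m s).choose

lemma isM_m (s : G) : α.IsM s (α.m s) := (α.existsUnique_m s).choose_spec.1

end PartialAction

/-- The multiplier algebra `M(E)` of a C⋆-algebra `E`, realized in the double dual:
`M(E) = {x ∈ E** | x E ∪ E x ⊆ E}`. -/
def multiplierAlgebra (E : Type*) [NonUnitalCStarAlgebra E] : Set (Bidual E) :=
  {x | ∀ a : E, Bidual.mul x (Bidual.ofElem a) ∈ Set.range (Bidual.ofElem (E := E)) ∧
    Bidual.mul (Bidual.ofElem a) x ∈ Set.range (Bidual.ofElem (E := E))}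

end

/-! The element `p s` is central relative to `A`, acts as the identity on the image of `D s`**, and
cuts `D s` out of `A`: an element `c` of `A` with `c p_s = c` lies in `D s`, by Hahn-Banach
(`ofElem_mul_p`, `mem_of_ofElem_mul_p_eq`). So if `p s` is a multiplier, every `a p_s` is an element
of `D s`. This gives (ii), and also (iii), since `x a = x (p_s a)` for `x` in `M(D_s)`. Conversely,
(ii) puts `a p_s` in `A`, and (iii) applied to the identity of `D s`** returns `p s`.

For (iv) ⇒ (i), let `T` be the Fourier coefficient at `s`, with `T (F(a, s)) = a`. Its double
transpose sends `a m_s` to `a p_s`; if `a m_s` lies in the crossed product, then `a p_s` lies in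
`A`. The real work is the boundedness of `T`, that is, the domination of each coefficient by the
greatest C⋆-seminorm. For this it suffices to find one C⋆-seminorm dominating it: the operator norm
of right multiplication on `L_c`, viewed as a left Hilbert `A`-module with inner product the value
of `y x*` at the identity.

For the last claim, `m_s a = m_s (p_{s⁻¹} a)` and `a m_s = (a p_s) m_s`, where `p_{s⁻¹} a` and `a
p_s` lie in the ideals on which `m s` acts by known formulas. Density of the span of the `F(b, t)`,
the factorization of these elements and the closedness of the crossed product in its double dual do
the rest. -/

noncomputable section

/-! ### Fourier coefficients on `L_c` and its Hilbert `A`-module structure. -/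

namespace PartialAction

variable {G A : Type*} [Group G] [NonUnitalCStarAlgebra A] (α : PartialAction G A)

namespace Lc

/-- The value `f s` of `f ∈ L_c`, as an element of `A`. -/
def coeff (s : G) : α.Lc →ₗ[ℂ] A :=
  (α.incl s : α.D s →ₗ[ℂ] A).comp (DirectSum.component ℂ G (fun s => α.D s) s)

lemma coeff_F_self (s : G) (a : α.D s) : coeff α s (F α s a) = a := by
  classical
  exact congrArg Subtype.val (DirectSum.component.lof_self ℂ (M := fun s => α.D s) s a)

lemma coeff_F_of_ne {s t : G} (h : t ≠ s) (a : α.D t) : coeff α s (F α t a) = 0 := by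
  classical
  have := DirectSum.component.of ℂ (M := fun s => α.D s) s t a
  rw [dif_neg h] at this
  exact congrArg Subtype.val this

lemma eq_zero_of_coeff_eq_zero {x : α.Lc} (h : ∀ s, coeff α s x = 0) : x = 0 :=
  DFinsupp.ext fun s => Subtype.ext (h s)

lemma coeff_ofA_mul (s : G) (a : A) (x : α.Lc) : coeff α s (ofA α a * x) = a * coeff α s x := by
  induction x using ind with
  | h0 => simp
  | hadd x y hx hy => rw [mul_add, map_add, map_add, mul_add, hx, hy]
  | hF t b =>
    rw [ofA_mul_F]
    by_cases h : t = s
    · subst h; rw [coeff_F_self, coeff_F_self]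
    · rw [coeff_F_of_ne α h, coeff_F_of_ne α h, mul_zero]

lemma coeff_one_star (x : α.Lc) : coeff α 1 (star x) = star (coeff α 1 x) := by
  induction x using ind with
  | h0 => simp
  | hadd x y hx hy => simp only [star_add, map_add, hx, hy]
  | hF t b =>
    by_cases h : t = 1
    · subst h
      have : F α 1 b = ofA α b := rfl
      rw [this, ← ofA_star, ofA_apply, ofA_apply, coeff_F_self, coeff_F_self]
    · rw [star_F, coeff_F_of_ne α h, coeff_F_of_ne α (by simpa using h), star_zero]

/-- The outer `α_s` undoes both inner `α_s⁻¹`, so the action disappears. This is why the inner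
product below is the plain sum of the `y_s x_s*`. -/
lemma F_mul_star_F_self {s : G} (a b : α.D s) :
    F α s a * star (F α s b) = ofA α ((a : A) * star (b : A)) := by
  rw [star_F, F_mul_F, ofA_apply]
  refine F_congr α (mul_inv_cancel s) ?_
  have hb : star (b : A) ∈ α.D s := star_mem b.2
  rw [coe_mulD, coe_starD, α.act_mul (α.act_inv_mem a.2) (α.act_inv_mem hb), α.act_act_inv a.2,
    α.act_act_inv hb]

/-- The product of `F(b, r)` with the adjoint of `F(a, t)` sits at `r t⁻¹`, so only equal indices
reach the identity. Allowing every larger `T` lets the induction unite two index sets, and lets a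
prescribed index be added later. -/
lemma coeff_one_mul_star (x y : α.Lc) : ∃ S : Finset G, ∀ T, S ⊆ T →
    coeff α 1 (y * star x) = ∑ s ∈ T, coeff α s y * star (coeff α s x) := by
  classical
  induction x using ind with
  | h0 => exact ⟨∅, fun T _ => by simp⟩
  | hadd x x' hx hx' =>
    obtain ⟨S, hS⟩ := hx
    obtain ⟨S', hS'⟩ := hx'
    refine ⟨S ∪ S', fun T hT => ?_⟩
    simp only [star_add, mul_add, map_add, Finset.sum_add_distrib]
    rw [hS T (Finset.union_subset_left hT), hS' T (Finset.union_subset_right hT)]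
  | hF t a =>
    refine ⟨{t}, fun T hT => ?_⟩
    have ht : t ∈ T := by simpa using hT
    rw [Finset.sum_eq_single_of_mem t ht fun s _ hs => by
      rw [coeff_F_of_ne α hs.symm, star_zero, mul_zero], coeff_F_self]
    induction y using ind with
    | h0 => simp
    | hadd x y hx hy => simp only [add_mul, map_add, hx, hy]
    | hF r b =>
      by_cases h : r = t
      · subst h
        rw [F_mul_star_F_self, ofA_apply, coeff_F_self, coeff_F_self]
      · rw [star_F, F_mul_F, coeff_F_of_ne α h, zero_mul, coeff_F_of_ne]
        rwa [ne_eq, mul_inv_eq_one]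

/-- The left action `a • x = F(a, e) x` of `A` on `L_c`. -/
instance : SMul A α.Lc := ⟨fun a x => ofA α a * x⟩

/-- The `A`-valued inner product on `L_c`, the value of `y x*` at the identity. -/
instance : Inner A α.Lc := ⟨fun x y => coeff α 1 (y * star x)⟩

/-- This is the Hilbert module norm, the square root of the norm of the inner product of `x` with
itself; it is not the C⋆-seminorm that defines the crossed product. -/
instance : Norm α.Lc := CStarModule.norm A

lemma inner_def (x y : α.Lc) : inner A x y = coeff α 1 (y * star x) := rfl

/-- Right multiplications by `f` and `star f` are adjoint to each other; this is the source of the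
C⋆-identity of the reduced seminorm. -/
lemma inner_mul_right (x y f : α.Lc) : inner A (x * f) y = inner A x (y * star f) := by
  rw [inner_def, inner_def, star_mul, mul_assoc]

section Order

variable [PartialOrder A] [StarOrderedRing A]

lemma coeff_mul_star_le_inner (s : G) (x : α.Lc) :
    coeff α s x * star (coeff α s x) ≤ inner A x x := by
  classical
  obtain ⟨S, hS⟩ := coeff_one_mul_star α x x
  -- Inserting `s` guarantees that the wanted term occurs in this sum of positive elements.
  rw [inner_def, hS (insert s S) (Finset.subset_insert _ _)]
  exact Finset.single_le_sum (f := fun s => coeff α s x * star (coeff α s x))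
    (fun i _ => mul_star_self_nonneg _) (Finset.mem_insert_self _ _)

/-- `L_c` is a Hilbert module over `A`. -/
instance : CStarModule A α.Lc where
  inner_add_right := by intros; simp only [inner_def, add_mul, map_add]
  inner_self_nonneg {x} := (mul_star_self_nonneg _).trans (coeff_mul_star_le_inner α 1 x)
  inner_self {x} := by
    refine ⟨fun h => eq_zero_of_coeff_eq_zero α fun s => ?_, fun h => by simp [inner_def, h]⟩
    have h1 := coeff_mul_star_le_inner α s x
    rw [h] at h1
    exact CStarRing.mul_star_self_eq_zero_iff _ |>.1 (le_antisymm h1 (mul_star_self_nonneg _))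
  inner_op_smul_right {a x y} := by
    change coeff α 1 (ofA α a * y * star x) = a * coeff α 1 (y * star x)
    rw [mul_assoc, coeff_ofA_mul]
  inner_smul_right_complex := by intros; simp only [inner_def, smul_mul_assoc, map_smul]
  star_inner x y := by simp only [inner_def, ← coeff_one_star, star_mul, star_star]
  norm_eq_sqrt_norm_inner_self x := rfl

/-- The norm of `L_c` as a Hilbert module over `A`. -/
instance : NormedAddCommGroup α.Lc :=
  { CStarModule.normedAddCommGroup A (E := α.Lc) with
    toAddCommGroup := inferInstanceAs (AddCommGroup α.Lc) }

instance : NormedSpace ℂ α.Lc where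
  norm_smul_le c x := ((CStarModule.normedSpaceCore A (E := α.Lc)).norm_smul c x).le

lemma norm_coeff_le (s : G) (x : α.Lc) : ‖coeff α s x‖ ≤ ‖x‖ := by
  refine le_of_sq_le_sq ?_ (norm_nonneg _)
  rw [CStarModule.norm_sq_eq A (x := x), sq, ← CStarRing.norm_self_mul_star]
  exact CStarAlgebra.norm_le_norm_of_nonneg_of_le (mul_star_self_nonneg _)
    (coeff_mul_star_le_inner α s x)

lemma norm_ofA (a : A) : ‖ofA α a‖ = ‖a‖ := by
  rw [← sq_eq_sq₀ (norm_nonneg _) (norm_nonneg _), CStarModule.norm_sq_eq A, inner_def,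
    ← ofA_star, ← ofA_mul, ofA_apply, coeff_F_self, CStarRing.norm_self_mul_star, sq]

end Order

end Lc

end PartialAction

/-! ### Boundedness of right multiplication and the reduced C⋆-seminorm. -/

/-- The functional calculus provides a formal square root `1 - c` of `1 - a a*`. -/
lemma exists_isSelfAdjoint_add_self_sub_sq {A : Type*} [NonUnitalCStarAlgebra A] (a : A)
    (ha : ‖a‖ ≤ 1) : ∃ c : A, IsSelfAdjoint c ∧ c + c - c * c = a * star a := by
  let _ : PartialOrder A := CStarAlgebra.spectralOrder A
  have _ : StarOrderedRing A := CStarAlgebra.spectralOrderedRing A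
  have hn : ‖a * star a‖ ≤ 1 := by
    rw [CStarRing.norm_self_mul_star]; nlinarith [norm_nonneg a]
  -- For `x ≤ 1` this solves `2 f - f² = x`, i.e. `(1 - f)² = 1 - x`. It vanishes at `0`, as the
  -- non-unital functional calculus requires.
  let f : ℝ → ℝ := fun x => 1 - √(1 - x)
  have hf : Continuous f := by fun_prop
  have hf0 : f 0 = 0 := by simp [f]
  refine ⟨cfcₙ f (a * star a), cfcₙ_predicate f _, ?_⟩
  rw [← cfcₙ_add f f (a * star a), ← cfcₙ_mul f f (a * star a), ← cfcₙ_sub ..]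
  conv_rhs => rw [← cfcₙ_id' ℝ (a * star a)]
  refine cfcₙ_congr fun x hx => ?_
  have h1 : x ≤ 1 := (le_abs_self x).trans
    ((NonUnitalIsometricContinuousFunctionalCalculus.norm_quasispectrum_le _ hx).trans hn)
  have h2 := Real.mul_self_sqrt (sub_nonneg.2 h1)
  simp only [f]
  linarith

namespace PartialAction

variable {G A : Type*} [Group G] [NonUnitalCStarAlgebra A] (α : PartialAction G A)

namespace Lc

section Order

variable [PartialOrder A] [StarOrderedRing A]

/-- With `a a* = 1 - (1 - c)²`, the inner square of `x F(a, s)` is that of `x` minus that of `x (1 -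
c)`, and the latter is positive. As there may be no unit, `x (1 - c)` is written `x - x * ofA α c`.
-/
lemma norm_mul_F_le_of_norm_le_one (x : α.Lc) {s : G} (a : α.D s) (ha : ‖a‖ ≤ 1) :
    ‖x * F α s a‖ ≤ ‖x‖ := by
  obtain ⟨c, hc, hca⟩ := exists_isSelfAdjoint_add_self_sub_sq (a : A) ha
  refine le_of_sq_le_sq ?_ (norm_nonneg _)
  rw [CStarModule.norm_sq_eq A, CStarModule.norm_sq_eq A]
  refine CStarAlgebra.norm_le_norm_of_nonneg_of_le CStarModule.inner_self_nonneg ?_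
  have h : (0 : A) ≤ inner A (x - x * ofA α c) (x - x * ofA α c) :=
    CStarModule.inner_self_nonneg (A := A) (E := α.Lc)
  have e : (inner A (x * F α s a) (x * F α s a) : A)
      = inner A x x - inner A (x - x * ofA α c) (x - x * ofA α c) := by
    rw [inner_mul_right, mul_assoc, F_mul_star_F_self, ← hca]
    simp only [inner_def, star_sub, star_mul, ← ofA_star, hc.star_eq, sub_mul, mul_sub, mul_add,
      add_mul, map_add, map_sub, ofA_mul, mul_assoc]
    abel
  rw [e]
  exact sub_le_self _ h

lemma norm_mul_F_le (x : α.Lc) {s : G} (a : α.D s) : ‖x * F α s a‖ ≤ ‖a‖ * ‖x‖ := by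
  rcases eq_or_ne a 0 with rfl | h
  · simp
  have hn : 0 < ‖a‖ := norm_pos_iff.2 h
  have h1 := norm_mul_F_le_of_norm_le_one α x (((‖a‖⁻¹ : ℝ) : ℂ) • a) (by
    rw [norm_smul, Complex.norm_real, norm_inv, norm_norm, inv_mul_cancel₀ hn.ne'])
  rw [map_smul, mul_smul_comm, norm_smul] at h1
  simp only [Complex.norm_real, norm_inv, norm_norm] at h1
  rwa [inv_mul_le_iff₀ hn] at h1

lemma exists_norm_mul_le (f : α.Lc) : ∃ C, ∀ x : α.Lc, ‖x * f‖ ≤ C * ‖x‖ := by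
  induction f using ind with
  | h0 => exact ⟨0, fun x => by simp⟩
  | hF s a => exact ⟨‖a‖, fun x => norm_mul_F_le α x a⟩
  | hadd f g hf hg =>
    obtain ⟨C, hC⟩ := hf
    obtain ⟨C', hC'⟩ := hg
    refine ⟨C + C', fun x => ?_⟩
    rw [mul_add, add_mul]
    exact (norm_add_le _ _).trans (add_le_add (hC x) (hC' x))

/-- Right multiplication by `f`, as a bounded operator on `L_c`. -/
def mulRightCLM (f : α.Lc) : α.Lc →L[ℂ] α.Lc :=
  LinearMap.mkContinuousOfExistsBound (LinearMap.mulRight ℂ f) (exists_norm_mul_le α f)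

lemma mulRightCLM_apply (f x : α.Lc) : mulRightCLM α f x = x * f := rfl

/-- Moving `f` across the inner product turns the inner square of `x f` into the inner product of
`x` with `x f f*`; then Cauchy-Schwarz applies. -/
lemma norm_mulRightCLM_sq_le (f : α.Lc) : ‖mulRightCLM α f‖ ^ 2 ≤ ‖mulRightCLM α (f * star f)‖ := by
  refine (Real.le_sqrt (norm_nonneg _) (norm_nonneg _)).1 ?_
  refine ContinuousLinearMap.opNorm_le_bound _ (Real.sqrt_nonneg _) fun x => ?_
  refine le_of_sq_le_sq ?_ (by positivity)
  rw [mul_pow, Real.sq_sqrt (norm_nonneg _), mulRightCLM_apply, CStarModule.norm_sq_eq A,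
    inner_mul_right, mul_assoc]
  calc _ ≤ ‖x‖ * ‖mulRightCLM α (f * star f) x‖ := CStarModule.norm_inner_le α.Lc
    _ ≤ ‖x‖ * (‖mulRightCLM α (f * star f)‖ * ‖x‖) := by
      gcongr; exact ContinuousLinearMap.le_opNorm _ _
    _ = _ := by ring

/-- Right multiplication reverses products, which is harmless because only operator norms are used.
-/
lemma mulRightCLM_mul (f g : α.Lc) :
    mulRightCLM α (f * g) = (mulRightCLM α g).comp (mulRightCLM α f) := by
  ext1 x
  exact (mul_assoc x f g).symm

lemma norm_mulRightCLM_mul_le (f g : α.Lc) :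
    ‖mulRightCLM α (f * g)‖ ≤ ‖mulRightCLM α f‖ * ‖mulRightCLM α g‖ := by
  rw [mulRightCLM_mul, mul_comm]
  exact ContinuousLinearMap.opNorm_comp_le _ _

/-- Submultiplicativity bounds the square of the left side by the product of the two sides; one
factor cancels unless it is zero. -/
lemma norm_mulRightCLM_le_star (f : α.Lc) : ‖mulRightCLM α f‖ ≤ ‖mulRightCLM α (star f)‖ := by
  have h := (norm_mulRightCLM_sq_le α f).trans (norm_mulRightCLM_mul_le α f (star f))
  rcases (norm_nonneg (mulRightCLM α f)).eq_or_lt with h0 | h0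
  · rw [← h0]; exact norm_nonneg _
  · exact le_of_mul_le_mul_left (by rwa [sq] at h) h0

lemma norm_mulRightCLM_star (f : α.Lc) : ‖mulRightCLM α (star f)‖ = ‖mulRightCLM α f‖ :=
  le_antisymm (by simpa using norm_mulRightCLM_le_star α (star f)) (norm_mulRightCLM_le_star α f)

/-- The reduced C⋆-seminorm on `L_c`. -/
def reducedSeminorm : CStarSeminorm α.Lc where
  toFun f := ‖mulRightCLM α f‖
  map_zero' := by
    rw [show mulRightCLM α 0 = 0 from by ext1 x; exact mul_zero x, norm_zero]
  add_le' f g := by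
    rw [show mulRightCLM α (f + g) = mulRightCLM α f + mulRightCLM α g from by
      ext1 x; exact mul_add x f g]
    exact norm_add_le _ _
  neg' f := by
    rw [show mulRightCLM α (-f) = -mulRightCLM α f from by ext1 x; exact mul_neg x f, norm_neg]
  smul' c f := by
    rw [show mulRightCLM α (c • f) = c • mulRightCLM α f from by
      ext1 x; exact mul_smul_comm c x f, norm_smul]
  mul_le f g := norm_mulRightCLM_mul_le α f g
  star_mul_self f := by
    refine le_antisymm ?_ ?_
    · refine (norm_mulRightCLM_mul_le α (star f) f).trans_eq ?_
      rw [norm_mulRightCLM_star, ← sq]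
      rfl
    · have := norm_mulRightCLM_sq_le α (star f)
      rwa [norm_mulRightCLM_star, star_star] at this

/-- With `u` the coefficient of `f` at `s`, test the operator on the vector `ofA α (star u)`: it has
norm `‖u‖`, and its image has coefficient `u* u` at `s`, of norm `‖u‖²`. -/
lemma norm_coeff_le_reducedSeminorm (s : G) (f : α.Lc) :
    ‖coeff α s f‖ ≤ (reducedSeminorm α).toSeminorm f := by
  set u := coeff α s f
  rcases (norm_nonneg u).eq_or_lt with h0 | h0
  · rw [← h0]; exact apply_nonneg _ _
  refine le_of_mul_le_mul_right ?_ h0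
  calc ‖u‖ * ‖u‖ = ‖coeff α s (ofA α (star u) * f)‖ := by
        rw [coeff_ofA_mul, CStarRing.norm_star_mul_self]
    _ ≤ ‖mulRightCLM α f (ofA α (star u))‖ := norm_coeff_le α s _
    _ ≤ ‖mulRightCLM α f‖ * ‖ofA α (star u)‖ := ContinuousLinearMap.le_opNorm _ _
    _ = ‖mulRightCLM α f‖ * ‖u‖ := by rw [norm_ofA, norm_star]

end Order

lemma norm_coeff_le_greatest (s : G) (f : α.Lc) :
    ‖coeff α s f‖ ≤ (CStarSeminorm.greatest (bddAbove α)).toSeminorm f := by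
  let _ : PartialOrder A := CStarAlgebra.spectralOrder A
  have _ : StarOrderedRing A := CStarAlgebra.spectralOrderedRing A
  exact (norm_coeff_le_reducedSeminorm α s f).trans (CStarSeminorm.le_greatest _ _ f)

end Lc

/-- The Fourier coefficient at `s` is a bounded operator on the crossed product. -/
lemma exists_fourierCoeff (s : G) : ∃ T : α.CrossedProduct →L[ℂ] A, ∀ a, T (α.F s a) = a := by
  let q := CStarSeminorm.greatest (Lc.bddAbove α)
  -- The coefficient is contractive for the greatest C⋆-seminorm, so it extends from `L_c` to the
  -- completion.
  let T₀ : q.Pre →L[ℂ] A := LinearMap.mkContinuous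
    (show q.Pre →ₗ[ℂ] A from Lc.coeff α s) 1 fun x => by
      rw [_root_.one_mul]; exact Lc.norm_coeff_le_greatest α s x
  let i : q.Pre →L[ℂ] α.CrossedProduct := UniformSpace.Completion.toComplL
  have hd : DenseRange i := CStarSeminorm.Completion.denseRange_of q
  have hi : IsUniformInducing i := UniformSpace.Completion.isUniformInducing_coe q.Pre
  exact ⟨T₀.extend i, fun a =>
    (ContinuousLinearMap.extend_eq T₀ hd hi (Lc.F α s a)).trans (Lc.coeff_F_self α s a)⟩

end PartialAction

/-! ### The Arens product on the double dual. -/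

namespace Bidual

section NormedSpace

variable {E F : Type*} [NormedAddCommGroup E] [NormedSpace ℂ E]
  [NormedAddCommGroup F] [NormedSpace ℂ F]

lemma map_ofElem (T : E →L[ℂ] F) (a : E) : map T (ofElem a) = ofElem (T a) := rfl

lemma ofElem_add (a b : E) : ofElem (a + b) = ofElem a + ofElem b :=
  map_add (NormedSpace.inclusionInDoubleDual ℂ E) a b

lemma ofElem_smul (c : ℂ) (a : E) : ofElem (c • a) = c • ofElem a :=
  map_smul (NormedSpace.inclusionInDoubleDual ℂ E) c a

variable (E) in
lemma isometry_ofElem : Isometry (ofElem : E → Bidual E) :=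
  (NormedSpace.inclusionInDoubleDualLi ℂ).isometry

end NormedSpace

section Algebra

variable {E F : Type*} [NonUnitalNormedRing E] [NormedSpace ℂ E]
  [IsScalarTower ℂ E E] [SMulCommClass ℂ E E] [NonUnitalNormedRing F] [NormedSpace ℂ F]
  [IsScalarTower ℂ F F] [SMulCommClass ℂ F F]

lemma mul_assoc (x y z : Bidual E) : mul (mul x y) z = mul x (mul y z) := by
  ext φ
  simp only [mul_apply]
  congr 1
  ext a
  simp only [actLeft_apply, mul_apply]
  congr 1
  ext b
  simp only [actLeft_apply, actRight_apply]
  congr 1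
  ext c
  simp only [actRight_apply, _root_.mul_assoc]

lemma mul_add (x y z : Bidual E) : mul x (y + z) = mul x y + mul x z := by
  ext φ
  exact map_add x (actLeft y φ) (actLeft z φ)

lemma mul_smul (c : ℂ) (x y : Bidual E) : mul x (c • y) = c • mul x y := by
  ext φ
  exact map_smul x c (actLeft y φ)

lemma add_mul (x y z : Bidual E) : mul (x + y) z = mul x z + mul y z := rfl

lemma smul_mul (c : ℂ) (x y : Bidual E) : mul (c • x) y = c • mul x y := rfl

lemma norm_mul_le (x y : Bidual E) : ‖mul x y‖ ≤ ‖x‖ * ‖y‖ := by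
  refine ContinuousLinearMap.opNorm_le_bound _ (by positivity) fun φ => ?_
  rw [mul_apply, _root_.mul_assoc]
  refine (x.le_opNorm _).trans (mul_le_mul_of_nonneg_left ?_ (norm_nonneg _))
  refine ContinuousLinearMap.opNorm_le_bound _ (by positivity) fun a => ?_
  rw [actLeft_apply, _root_.mul_assoc]
  refine (y.le_opNorm _).trans (mul_le_mul_of_nonneg_left ?_ (norm_nonneg _))
  refine ContinuousLinearMap.opNorm_le_bound _ (by positivity) fun b => ?_
  rw [actRight_apply, _root_.mul_assoc]
  exact (φ.le_opNorm _).trans (mul_le_mul_of_nonneg_left (_root_.norm_mul_le _ _) (norm_nonneg _))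

lemma map_mul {T : E →L[ℂ] F} (hT : ∀ a b, T (a * b) = T a * T b) (x y : Bidual E) :
    map T (mul x y) = mul (map T x) (map T y) := by
  ext φ
  simp only [map_apply, mul_apply]
  congr 1
  ext a
  simp only [actLeft_apply, map_apply, ContinuousLinearMap.comp_apply]
  congr 1
  ext b
  simp [hT]

lemma ofElem_mul (a b : E) : ofElem (a * b) = mul (ofElem a) (ofElem b) := rfl

/-- The left multiplication `E → E**` by an element of `E**`. -/
def mulLeftCLM (x : Bidual E) : E →L[ℂ] Bidual E :=
  LinearMap.mkContinuous
    { toFun := fun a => mul x (ofElem a)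
      map_add' := fun a b => by rw [ofElem_add, mul_add]
      map_smul' := fun c a => by rw [ofElem_smul, mul_smul]; rfl } ‖x‖
    fun a => (norm_mul_le x (ofElem a)).trans_eq
      (congrArg (‖x‖ * ·) ((NormedSpace.inclusionInDoubleDualLi ℂ).norm_map a))

/-- The right multiplication `E → E**` by an element of `E**`. -/
def mulRightCLM (x : Bidual E) : E →L[ℂ] Bidual E :=
  LinearMap.mkContinuous
    { toFun := fun a => mul (ofElem a) x
      map_add' := fun a b => by rw [ofElem_add, add_mul]
      map_smul' := fun c a => by rw [ofElem_smul, smul_mul]; rfl } ‖x‖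
    fun a => (norm_mul_le (ofElem a) x).trans_eq ((mul_comm _ _).trans
      (congrArg (‖x‖ * ·) ((NormedSpace.inclusionInDoubleDualLi ℂ).norm_map a)))

end Algebra

/-- An isometric image of a complete space is closed. Hence whether an element of the double dual
multiplies `E` into `E` can be tested on a set with dense span. -/
lemma isClosed_range_ofElem (E : Type*) [NonUnitalCStarAlgebra E] :
    IsClosed (Set.range (ofElem : E → Bidual E)) :=
  (isometry_ofElem E).isClosedEmbedding.isClosed_range

end Bidual

/-! ### The projection `p s` and the equivalence of (i), (ii) and (iii). -/

namespace PartialAction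

open Bidual

variable {G A : Type*} [Group G] [NonUnitalCStarAlgebra A] (α : PartialAction G A)

lemma map_incl_mul {s : G} (x y : Bidual (α.D s)) :
    Bidual.map (α.incl s) (Bidual.mul x y)
      = Bidual.mul (Bidual.map (α.incl s) x) (Bidual.map (α.incl s) y) :=
  Bidual.map_mul (fun _ _ => rfl) x y

lemma p_mul_map_incl {s : G} (x : Bidual (α.D s)) :
    Bidual.mul (α.p s) (Bidual.map (α.incl s) x) = Bidual.map (α.incl s) x := by
  rw [p, ← map_incl_mul, Bidual.one_mul]

lemma map_incl_mul_p {s : G} (x : Bidual (α.D s)) :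
    Bidual.mul (Bidual.map (α.incl s) x) (α.p s) = Bidual.map (α.incl s) x := by
  rw [p, ← map_incl_mul, Bidual.mul_one]

lemma ofElem_mul_p_of_mem {s : G} {a : A} (ha : a ∈ α.D s) :
    Bidual.mul (ofElem a) (α.p s) = ofElem a :=
  α.map_incl_mul_p (ofElem (⟨a, ha⟩ : α.D s))

/-- The multiplication `b ↦ a b` on the ideal `D s`. -/
def idealMulLeft (s : G) (a : A) : α.D s →L[ℂ] α.D s :=
  ((ContinuousLinearMap.mul ℂ A a).comp (α.incl s)).codRestrict
    (α.D s).toNonUnitalSubalgebra.toSubmodule fun b => α.mul_mem_left s a b.2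

/-- The projection `p_s` is central. -/
lemma ofElem_mul_p (s : G) (a : A) :
    Bidual.mul (ofElem a) (α.p s) = Bidual.mul (α.p s) (ofElem a) := by
  let T := α.idealMulLeft s a
  have h1 : Bidual.mul (ofElem a) (α.p s)
      = Bidual.map (α.incl s) (Bidual.map T (Bidual.one (α.D s))) := rfl
  rw [h1]
  ext φ
  -- The extra unit on the left brings in the products of `d ∈ D s` with `T**(1)`, which equal `d
  -- a`. Both sides then evaluate the unit of `D s`** at the functional `d ↦ φ (d a)`.
  conv_lhs => rw [← Bidual.one_mul (Bidual.map T (Bidual.one (α.D s)))]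
  show Bidual.one (α.D s) (actLeft _ (φ.comp (α.incl s))) = Bidual.one (α.D s) _
  congr 1
  ext d
  have h2 : (actRight (φ.comp (α.incl s)) d).comp T
      = actRight (φ.comp (α.incl s)) ⟨d * a, α.mul_mem_right s a d.2⟩ := by
    ext b
    exact congrArg φ (_root_.mul_assoc (d : A) a b).symm
  rw [actLeft_apply, Bidual.map_apply, h2, one_actRight]
  rfl

/-- Otherwise Hahn-Banach in the quotient of `A` by the closed ideal gives `φ` vanishing on `D s`
with `φ c ≠ 0`. But `c p_s` takes at `φ` the value of the unit of `D s`** at `b ↦ φ (c b)`, which is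
the zero functional. -/
lemma mem_of_ofElem_mul_p_eq {s : G} {c : A} (h : Bidual.mul (ofElem c) (α.p s) = ofElem c) :
    c ∈ α.D s := by
  by_contra hc
  let K : Submodule ℂ A := (α.D s).toNonUnitalSubalgebra.toSubmodule
  have _ : IsClosed (K : Set A) := α.isClosed_D s
  obtain ⟨ψ, -, hψ⟩ := exists_dual_vector ℂ (K.mkQL c) (norm_ne_zero_iff.2
    fun h0 => hc ((Submodule.Quotient.mk_eq_zero K).1 h0))
  let φ : StrongDual ℂ A := ψ.comp K.mkQL
  have h1 : φ c ≠ 0 := fun h0 => hc <| (Submodule.Quotient.mk_eq_zero K).1 <| norm_eq_zero.1 <|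
    Complex.ofReal_eq_zero.1 (hψ.symm.trans h0)
  have h2 : ∀ b ∈ α.D s, φ b = 0 := fun b hb =>
    (congrArg ψ ((Submodule.Quotient.mk_eq_zero K).2 hb)).trans (map_zero ψ)
  refine h1 ?_
  have h3 := congrArg (fun x : Bidual A => x φ) h
  have h4 : (actRight φ c).comp (α.incl s) = 0 := by
    ext b
    exact h2 _ (α.mul_mem_left s c b.2)
  refine h3.symm.trans ?_
  show Bidual.one (α.D s) ((actRight φ c).comp (α.incl s)) = 0
  rw [h4, map_zero]

/-- The element `a p_s` lies in `A` by hypothesis and is fixed by `p s` because `p s` is idempotent,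
so it belongs to the ideal. -/
lemma exists_mem_ofElem_mul_p {s : G} (h : α.p s ∈ multiplierAlgebra A) (a : A) :
    ∃ c ∈ α.D s, Bidual.mul (ofElem a) (α.p s) = ofElem c := by
  obtain ⟨c, hc⟩ := (h a).2
  refine ⟨c, α.mem_of_ofElem_mul_p_eq ?_, hc.symm⟩
  rw [hc, Bidual.mul_assoc]
  exact congrArg (Bidual.mul (ofElem a)) (α.p_mul_map_incl (Bidual.one (α.D s)))

lemma p_mem_multiplierAlgebra_of_forall {s : G}
    (h : ∀ a : A, Bidual.mul (ofElem a) (α.p s) ∈ Set.range (ofElem (E := A))) :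
    α.p s ∈ multiplierAlgebra A :=
  fun a => ⟨α.ofElem_mul_p s a ▸ h a, h a⟩

lemma p_mem_multiplierAlgebra_iff_image_eq_range (s : G) :
    α.p s ∈ multiplierAlgebra A ↔ ofElem '' (α.D s : Set A)
      = Set.range fun a : A => Bidual.mul (ofElem a) (α.p s) := by
  refine ⟨fun h => ?_, fun h => α.p_mem_multiplierAlgebra_of_forall fun a => ?_⟩
  · apply Set.Subset.antisymm
    · rintro _ ⟨a, ha, rfl⟩
      exact ⟨a, α.ofElem_mul_p_of_mem ha⟩
    · rintro _ ⟨a, rfl⟩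
      obtain ⟨c, hc, hac⟩ := α.exists_mem_ofElem_mul_p h a
      exact ⟨c, hc, hac.symm⟩
  · have : Bidual.mul (ofElem a) (α.p s) ∈ ofElem '' (α.D s : Set A) := h ▸ ⟨a, rfl⟩
    exact Set.image_subset_range _ _ this

lemma p_mem_multiplierAlgebra_iff_image_subset (s : G) :
    α.p s ∈ multiplierAlgebra A ↔
      Bidual.map (α.incl s) '' multiplierAlgebra (α.D s) ⊆ multiplierAlgebra A := by
  -- The multiplier that `rfl` selects for the converse is the identity of `D s`**, whose image is
  -- `p s`.
  refine ⟨?_, fun h => h ⟨_, fun a => ?_, rfl⟩⟩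
  · rintro h _ ⟨x, hx, rfl⟩ a
    obtain ⟨c, hc, hac⟩ := α.exists_mem_ofElem_mul_p h a
    obtain ⟨⟨d, hd⟩, ⟨d', hd'⟩⟩ := hx ⟨c, hc⟩
    constructor
    · refine ⟨d, ?_⟩
      -- A factor `p s` split off from `x` is absorbed by `a`, which replaces `a` by `c ∈ D s`.
      rw [← map_incl_mul_p, Bidual.mul_assoc, ← ofElem_mul_p, hac]
      exact (congrArg (Bidual.map (α.incl s)) hd).trans (α.map_incl_mul _ _)
    · refine ⟨d', ?_⟩
      rw [← p_mul_map_incl, ← Bidual.mul_assoc, hac]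
      exact (congrArg (Bidual.map (α.incl s)) hd').trans (α.map_incl_mul _ _)
  · rw [Bidual.one_mul, Bidual.mul_one]
    exact ⟨⟨a, rfl⟩, ⟨a, rfl⟩⟩

/-! ### The element `m s` and condition (iv). -/

lemma m_eq_map (s : G) : α.m s = Bidual.map (α.F s) (Bidual.one (α.D s)) :=
  α.isM_unique (α.isM_m s)

/-- The Fourier coefficient `T` satisfies `T (F(a, e) F(b, s)) = a b`, so `T**` carries `a m_s` to
`a p_s`. It also carries elements of the crossed product into `A`. -/
lemma p_mem_of_m_mem {s : G} (h : α.m s ∈ multiplierAlgebra α.CrossedProduct) :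
    α.p s ∈ multiplierAlgebra A := by
  obtain ⟨T, hT⟩ := α.exists_fourierCoeff s
  refine α.p_mem_multiplierAlgebra_of_forall fun a => ?_
  obtain ⟨x, hx⟩ := (h (α.ofA a)).2
  refine ⟨T x, ?_⟩
  rw [← map_ofElem, hx, m_eq_map]
  ext ψ
  show Bidual.one (α.D s) ((actRight (ψ.comp T) (α.ofA a)).comp (α.F s))
    = Bidual.one (α.D s) ((actRight ψ a).comp (α.incl s))
  congr 1
  ext b
  show ψ (T (α.ofA a * α.F s b)) = ψ (a * b)
  rw [ofA_mul_F, hT]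

lemma mem_of_isClosed_of_F_mem {K : Submodule ℂ α.CrossedProduct}
    (hK : IsClosed (K : Set α.CrossedProduct)) (h : ∀ t b, α.F t b ∈ K) (x : α.CrossedProduct) :
    x ∈ K := by
  refine CStarSeminorm.Completion.ind _ (P := fun x => x ∈ K) hK (fun f => ?_) x
  induction f using Lc.ind with
  | h0 => rw [map_zero]; exact K.zero_mem
  | hF t b => exact h t b
  | hadd f g hf hg => rw [map_add]; exact K.add_mem hf hg

lemma ofA_mul (a b : A) : α.ofA (a * b) = α.ofA a * α.ofA b := by
  rw [ofA_apply, ofA_apply, ofA_apply, ← CStarSeminorm.Completion.of_mul, Lc.ofA_mul]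

/-- Positive elements of `D t` are squares and span it, so products of two elements suffice. -/
lemma F_mem_of_F_mul_mem {K : Submodule ℂ α.CrossedProduct} {t : G}
    (h : ∀ a b : α.D t, α.F t (a * b) ∈ K) (b : α.D t) : α.F t b ∈ K := by
  -- `mul_induction` takes a predicate on `A`, so the membership proof is moved into the predicate.
  suffices h' : ∀ hb : (b : A) ∈ α.D t, α.F t ⟨b, hb⟩ ∈ K from h' b.2
  refine α.mul_induction (s := t) (P := fun b => ∀ hb : b ∈ α.D t, α.F t ⟨b, hb⟩ ∈ K)
    ?_ ?_ ?_ ?_ b.2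
  · intro hb
    rw [show (⟨0, hb⟩ : α.D t) = 0 from rfl, map_zero]
    exact K.zero_mem
  · intro x y hx hy ihx ihy hb
    rw [show (⟨x + y, hb⟩ : α.D t) = ⟨x, hx⟩ + ⟨y, hy⟩ from rfl, map_add]
    exact K.add_mem (ihx hx) (ihy hy)
  · intro c x hx ih hb
    rw [show (⟨c • x, hb⟩ : α.D t) = c • ⟨x, hx⟩ from rfl, map_smul]
    exact K.smul_mem c (ih hx)
  · intro x y hx hy hb
    exact h ⟨x, hx⟩ ⟨y, hy⟩

/-- Every `F(b, t)` is a sum of products `F(a, e) F(d, t)`. -/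
lemma F_mem_of_ofA_mul_F_mem {K : Submodule ℂ α.CrossedProduct} {t : G}
    (h : ∀ (a : A) (d : α.D t), α.ofA a * α.F t d ∈ K) (b : α.D t) : α.F t b ∈ K :=
  α.F_mem_of_F_mul_mem (fun x y => (α.ofA_mul_F x y).symm ▸ h x y) b

/-- Every `F(b, t)` is a sum of products `F(d, t) F(a, e)`. -/
lemma F_mem_of_F_mul_ofA_mem {K : Submodule ℂ α.CrossedProduct} {t : G}
    (h : ∀ (d : α.D t) (a : A), α.F t d * α.ofA a ∈ K) (b : α.D t) : α.F t b ∈ K := by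
  refine α.F_mem_of_F_mul_mem (fun x y => ?_) b
  -- Passing a coefficient from the right of `F(x, t)` into the fibre applies `α_t`; hence the
  -- factor `α_t⁻¹(y)`.
  have e : α.F t x * α.ofA ((α.α t).symm y) = α.F t (x * y) := by
    rw [F_mul_ofA]
    change α.F t (α.α t ((α.α t).symm x * (α.α t).symm y)) = _
    rw [← _root_.map_mul, StarAlgEquiv.apply_symm_apply]
  exact e ▸ h x _

lemma pCross_mul_ofA {s : G} (h : α.p s ∈ multiplierAlgebra A) (a : A) : ∃ c : α.D s,
    Bidual.mul (α.pCross s) (ofElem (α.ofA a)) = ofElem (α.ofA c) ∧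
    Bidual.mul (ofElem (α.ofA a)) (α.pCross s) = ofElem (α.ofA c) := by
  obtain ⟨c, hc, hac⟩ := α.exists_mem_ofElem_mul_p h a
  have h1 := congrArg (Bidual.map α.ofA) hac
  have h2 := congrArg (Bidual.map α.ofA) ((α.ofElem_mul_p s a).symm.trans hac)
  rw [Bidual.map_mul α.ofA_mul] at h1 h2
  exact ⟨⟨c, hc⟩, h2, h1⟩

/-- On the total set of products `F(a, e) F(d, t)`, the right support `p_{s⁻¹}` of `m s` replaces
`a` by some `c ∈ D_{s⁻¹}`, and then `m_s c = F(α_s(c), s)`. The general case follows by closedness.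
-/
lemma m_mul_mem_range {s : G} (h : α.p s⁻¹ ∈ multiplierAlgebra A) (x : α.CrossedProduct) :
    Bidual.mul (α.m s) (ofElem x) ∈ Set.range (ofElem (E := α.CrossedProduct)) := by
  let K : Submodule ℂ α.CrossedProduct :=
    (LinearMap.range (NormedSpace.inclusionInDoubleDual ℂ α.CrossedProduct).toLinearMap).comap
      (Bidual.mulLeftCLM (α.m s)).toLinearMap
  have hK : IsClosed (K : Set α.CrossedProduct) :=
    (Bidual.isClosed_range_ofElem α.CrossedProduct).preimage (Bidual.mulLeftCLM (α.m s)).continuous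
  refine α.mem_of_isClosed_of_F_mem hK (fun t b => ?_) x
  refine α.F_mem_of_ofA_mul_F_mem (fun a d => ?_) b
  show Bidual.mul (α.m s) (ofElem (α.ofA a * α.F t d)) ∈ Set.range (ofElem (E := α.CrossedProduct))
  obtain ⟨c, hc, -⟩ := α.pCross_mul_ofA h a
  refine ⟨α.F s (α.α s c) * α.F t d, ?_⟩
  rw [ofElem_mul, ofElem_mul, ← (α.isM_m s).mul_right, ← hc, ← Bidual.mul_assoc (α.m s),
    (α.isM_m s).right, Bidual.mul_assoc]

/-- The mirror image, with the left support: `F(d, t) a m_s = F(d, t) (a p_s) m_s = F(d, t) F(c,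
s)`, where `c = a p_s ∈ D s`. -/
lemma mul_m_mem_range {s : G} (h : α.p s ∈ multiplierAlgebra A) (x : α.CrossedProduct) :
    Bidual.mul (ofElem x) (α.m s) ∈ Set.range (ofElem (E := α.CrossedProduct)) := by
  let K : Submodule ℂ α.CrossedProduct :=
    (LinearMap.range (NormedSpace.inclusionInDoubleDual ℂ α.CrossedProduct).toLinearMap).comap
      (Bidual.mulRightCLM (α.m s)).toLinearMap
  have hK : IsClosed (K : Set α.CrossedProduct) :=
    (Bidual.isClosed_range_ofElem α.CrossedProduct).preimage
      (Bidual.mulRightCLM (α.m s)).continuous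
  refine α.mem_of_isClosed_of_F_mem hK (fun t b => ?_) x
  refine α.F_mem_of_F_mul_ofA_mem (fun d a => ?_) b
  show Bidual.mul (ofElem (α.F t d * α.ofA a)) (α.m s) ∈ Set.range (ofElem (E := α.CrossedProduct))
  obtain ⟨c, -, hc⟩ := α.pCross_mul_ofA h a
  refine ⟨α.F t d * α.F s c, ?_⟩
  rw [ofElem_mul, ofElem_mul, ← (α.isM_m s).mul_left, ← hc, Bidual.mul_assoc (ofElem (α.ofA a)),
    (α.isM_m s).left, Bidual.mul_assoc]

end PartialAction

end

theorem mainTheorem11 {G A : Type*} [Group G] [NonUnitalCStarAlgebra A]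
    (α : PartialAction G A) (s : G) :
    (α.p s ∈ multiplierAlgebra A ↔
      Bidual.ofElem '' (α.D s : Set A) =
        Set.range fun a : A => Bidual.mul (Bidual.ofElem a) (α.p s)) ∧
    (α.p s ∈ multiplierAlgebra A ↔
      Bidual.map (α.incl s) '' multiplierAlgebra (α.D s) ⊆ multiplierAlgebra A) ∧
    (α.m s ∈ multiplierAlgebra α.CrossedProduct → α.p s ∈ multiplierAlgebra A) ∧
    (α.p s ∈ multiplierAlgebra A → α.p s⁻¹ ∈ multiplierAlgebra A →
      α.m s ∈ multiplierAlgebra α.CrossedProduct) :=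
  ⟨α.p_mem_multiplierAlgebra_iff_image_eq_range s, α.p_mem_multiplierAlgebra_iff_image_subset s,
    α.p_mem_of_m_mem, fun h h' x => ⟨α.m_mul_mem_range h' x, α.mul_m_mem_range h x⟩⟩
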